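/- Conventions. Let $\mathcal A$ be an abelian category. It is a \emph{length category} if every object has a finite composition series. A length category is \emph{Ext-finite} if for all simple objects $S,T$ the group $\operatorname{Ext}^1(S,T)$ is finite dimensional over the division ring $\operatorname{End}(T)$, acting by composition. For objects $\Delta_1,\dots,\Delta_n$, $\operatorname{Filt}(\Delta_1,\dots,\Delta_n)$ denotes the objects $X$ having a finite filtration $0=X_0\subseteq X_1\subseteq\dots\subseteq X_t=X$ with each $X_k/X_{k-1}$ isomorphic to some $\Delta_j$, and $\operatorname{Serre}(\Delta_1,\dots,\Delta_n)$ denotes the smallest Serre subcategory containing $\Delta_1,\dots,\Delta_n$. A \emph{projective generator} is a projective object $P$ such that every object is a quotient of $P^r$ for some integer $r>0$. For a ring $\Gamma$, $\operatorname{mod}\Gamma$ is the category of finitely presented right $\Gamma$-modules. Full subcategories are closed under isomorphisms. An abelian length category $\mathcal A$ with finitely many simple objects up to isomorphism is a \emph{highest weight category} with \emph{standard objects} $\Delta_1,\dots,\Delta_n$ ($n\ge 0$) if there are exact sequences $0\to U_i\to P_i\to\Delta_i\to 0$ ($1\le i\le n$) such that (a) $\operatorname{End}(\Delta_i)$ is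 a division ring for all $i$; (b) $\operatorname{Hom}(\Delta_i,\Delta_j)=0$ for all $i>j$; (c) $U_i\in\operatorname{Filt}(\Delta_{i+1},\dots,\Delta_n)$ for all $i$; (d) $\bigoplus_{i=1}^n P_i$ is a projective generator of $\mathcal A$. A \emph{recollement} of abelian categories $\mathcal A'\to\mathcal A\to\mathcal A''$ consists of exact functors $i_*\colon\mathcal A'\to\mathcal A$ and $j^*\colon\mathcal A\to\mathcal A''$, a left adjoint $i^*$ and a right adjoint $i^!$ of $i_*$, and a left adjoint $j_!$ and a right adjoint $j_*$ of $j^*$, such that $i_*,j_!,j_*$ are fully faithful and an object of $\mathcal A$ is annihilated by $j^*$ if and only if it lies in the essential image of $i_*$. It is \emph{homological} if $i_*$ induces isomorphisms $\operatorname{Ext}^p_{\mathcal A'}(X,Y)\to\operatorname{Ext}^p_{\mathcal A}(i_*X,i_*Y)$ for all $X,Y\in\mathcal A'$ and $p\ge 0$. Theorem. Let $\mathcal A$ be an abelian length category with finitely many simple objects up to isomorphism, and suppose that $\mathcal A$ and $\mathcal A^{\mathrm{op}}$ are Ext-finite. Then the following are equivalent: (1) $\mathcal A$ is a highest weight category.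 (2) There are a finite chain $0=\mathcal A_0\subseteq\mathcal A_1\subseteq\dots\subseteq\mathcal A_n=\mathcal A$ of full subcategories, each of them an abelian category, and division rings $\Gamma_1,\dots,\Gamma_n$ such that each inclusion $\mathcal A_{i-1}\to\mathcal A_i$ is the functor $i_*$ of a homological recollement of abelian categories $\mathcal A_{i-1}\to\mathcal A_i\to\operatorname{mod}\Gamma_i$. Moreover, given any data as in (2), let $\Delta_i$ be the image of $\Gamma_i$ under the left adjoint $\operatorname{mod}\Gamma_i\to\mathcal A_i$. Then $\mathcal A$ is a highest weight category with standard objects $\Delta_1,\dots,\Delta_n$, and for $1\le i\le n$ $$\mathcal A_i=\operatorname{Serre}(\Delta_1,\dots,\Delta_i),\qquad \mathcal A_{i-1}=\{X\in\mathcal A_i\mid\operatorname{Hom}_{\mathcal A}(\Delta_i,X)=0\}.$$ Conversely, if $\mathcal A$ is a highest weight category with standard objects $\Delta_1,\dots,\Delta_n$, then there are data as in (2) (with the same $n$) for which the image of $\Gamma_i$ under the left adjoint $\operatorname{mod}\Gamma_i\to\mathcal A_i$ is isomorphic to $\Delta_i$ for all $i$, and the subcategories $\mathcal A_i$ are given by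 the same two formulas. -/

import Mathlib

open CategoryTheory CategoryTheory.Limits CategoryTheory.Abelian

universe v v₁ v₂ v₃ u u₁ u₂ u₃

namespace HighestWeight

noncomputable section

attribute [local instance] CategoryTheory.Abelian.hasFiniteBiproducts

section LengthCategories

variable {A : Type u} [Category.{v} A] [Abelian A]

/-- `Filt Q X`: the object `X` has a finite filtration `0 = X₀ ⊆ X₁ ⊆ ⋯ ⊆ X_t = X`
such that every factor `X_k / X_{k-1}` satisfies `Q` (the filtration is built up one factor
at a time, starting from a zero object). -/
inductive Filt (Q : ObjectProperty A) : A → Prop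
  | zero (X : A) (hX : IsZero X) : Filt Q X
  | step (S : ShortComplex A) (hS : S.ShortExact) (h₁ : Filt Q S.X₁) (h₃ : Q S.X₃) :
      Filt Q S.X₂

/-- `FiltObj s Δ` is the property of having a finite filtration all of whose factors are
isomorphic to some `Δ j` with `j ∈ s`. -/
def FiltObj {n : ℕ} (s : Set (Fin n)) (Δ : Fin n → A) (X : A) : Prop :=
  Filt (fun Y => ∃ j ∈ s, Nonempty (Y ≅ Δ j)) X

/-- `SerreObj s Δ` is the smallest Serre subcategory containing all `Δ j` with `j ∈ s`. -/
def SerreObj {n : ℕ} (s : Set (Fin n)) (Δ : Fin n → A) (X : A) : Prop :=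
  ∀ Q : ObjectProperty A, Q.IsSerreClass → (∀ j ∈ s, Q (Δ j)) → Q X

variable (A) in
/-- Every object has a finite composition series. -/
def IsLengthCategory : Prop :=
  ∀ X : A, Filt (fun S => Simple S) X

variable (A) in
/-- There are only finitely many isomorphism classes of simple objects. -/
def HasFinitelyManySimples : Prop :=
  ∃ (m : ℕ) (S : Fin m → A), ∀ T : A, Simple T → ∃ i, Nonempty (T ≅ S i)

/-- The action of `End Y` on `Ext X Y n` by composition. (The product `f * g` in `End Y` is
`f ∘ g`, so that this is a left action.) -/
abbrev extModuleEnd [HasExt.{max u v} A] (X Y : A) (n : ℕ) :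
    Module (End Y) (Ext.{max u v} X Y n) where
  smul f x := x.comp (Ext.mk₀ (End.asHom f)) (add_zero n)
  one_smul x := Ext.comp_mk₀_id x
  mul_smul f g x := by
    change x.comp (Ext.mk₀ (g ≫ f)) _ = (x.comp (Ext.mk₀ g) _).comp (Ext.mk₀ f) _
    rw [Ext.comp_assoc_of_third_deg_zero, Ext.mk₀_comp_mk₀]
  smul_zero f := Ext.zero_comp _ _ _ _ _
  smul_add f x y := Ext.add_comp _ _ _ _
  add_smul f g x := by
    change x.comp (Ext.mk₀ (f + g)) _ = x.comp (Ext.mk₀ f) _ + x.comp (Ext.mk₀ g) _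
    rw [Ext.mk₀_add, Ext.comp_add]
  zero_smul x := by
    change x.comp (Ext.mk₀ (0 : Y ⟶ Y)) _ = 0
    rw [Ext.mk₀_zero, Ext.comp_zero]

variable (A) in
/-- For all simple objects `S` and `T`, the group `Ext¹(S, T)` is finite dimensional over the
division ring of endomorphisms of `T`. -/
def ExtFinite : Prop :=
  letI : HasExt.{max u v} A := HasExt.standard A
  ∀ S T : A, Simple S → Simple T →
    letI := extModuleEnd S T 1
    Module.Finite (End T) (Ext.{max u v} S T 1)

end LengthCategories

section HighestWeightCategories

variable {A : Type u} [Category.{v} A] [Abelian A]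

/-- A projective object `P` such that every object is a quotient of `P ^ r` for some `r > 0`. -/
def IsProjectiveGenerator (P : A) : Prop :=
  Projective P ∧ ∀ X : A, ∃ r : ℕ, 0 < r ∧ ∃ p : (⨁ fun _ : Fin r => P) ⟶ X, Epi p

/-- `Δ` is the sequence of standard objects of a structure of highest weight category on `A`. -/
def IsStandardSequence {n : ℕ} (Δ : Fin n → A) : Prop :=
  ∃ (U P : Fin n → A) (f : ∀ i, U i ⟶ P i) (g : ∀ i, P i ⟶ Δ i) (w : ∀ i, f i ≫ g i = 0),
    (∀ i, (ShortComplex.mk (f i) (g i) (w i)).ShortExact) ∧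
    (∀ i, Nontrivial (End (Δ i)) ∧ ∀ x : End (Δ i), x ≠ 0 → IsUnit x) ∧
    (∀ i j, j < i → ∀ h : Δ i ⟶ Δ j, h = 0) ∧
    (∀ i, FiltObj (Set.Ioi i) Δ (U i)) ∧
    IsProjectiveGenerator (⨁ P)

variable (A) in
/-- The condition defining highest weight categories among the abelian length categories with
finitely many simple objects. -/
def IsHighestWeightCategory : Prop :=
  ∃ (n : ℕ) (Δ : Fin n → A), IsStandardSequence Δ

end HighestWeightCategories

section Recollements

/-- A preadditive category is abelian (as a property). -/
class IsAbelianCategory (C : Type u) [Category.{v} C] [Preadditive C] : Prop where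
  hasFiniteProducts : HasFiniteProducts C
  hasKernels : HasKernels C
  hasCokernels : HasCokernels C
  isNormalMonoCategory : IsNormalMonoCategory C
  isNormalEpiCategory : IsNormalEpiCategory C

/-- A preadditive category which is abelian, as an `Abelian` category in the sense of Mathlib,
with the same additive structure. -/
instance (priority := 50) abelianOfIsAbelianCategory (C : Type u) [Category.{v} C]
    [Preadditive C] [h : IsAbelianCategory C] : Abelian C where
  toIsNormalMonoCategory := h.isNormalMonoCategory
  toIsNormalEpiCategory := h.isNormalEpiCategory
  has_finite_products := h.hasFiniteProducts
  has_kernels := h.hasKernels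
  has_cokernels := h.hasCokernels

variable {A' : Type u₁} [Category.{v₁} A'] [Abelian A']
  {A : Type u₂} [Category.{v₂} A] [Abelian A]
  {A'' : Type u₃} [Category.{v₃} A''] [Abelian A'']

/-- Exact functors between abelian categories. -/
structure IsExactFunctor (F : A' ⥤ A) : Prop where
  additive : F.Additive
  preservesFiniteLimits : PreservesFiniteLimits F
  preservesFiniteColimits : PreservesFiniteColimits F

/-- A localisation sequence of abelian categories:
`i` is left adjoint to `r` and `j` is left adjoint to `s`. -/
structure LocalisationSequence (i : A' ⥤ A) (r : A ⥤ A') (j : A ⥤ A'') (s : A'' ⥤ A) where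
  exact_i : IsExactFunctor i
  exact_j : IsExactFunctor j
  adj_i : i ⊣ r
  adj_j : j ⊣ s
  full_i : i.Full
  faithful_i : i.Faithful
  full_s : s.Full
  faithful_s : s.Faithful
  isZero_iff : ∀ X : A, IsZero (j.obj X) ↔ i.essImage X

/-- A colocalisation sequence of abelian categories:
`l` is left adjoint to `i` and `t` is left adjoint to `j`. -/
structure ColocalisationSequence (i : A' ⥤ A) (l : A ⥤ A') (j : A ⥤ A'') (t : A'' ⥤ A) where
  exact_i : IsExactFunctor i
  exact_j : IsExactFunctor j
  adj_i : l ⊣ i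
  adj_j : t ⊣ j
  full_i : i.Full
  faithful_i : i.Faithful
  full_t : t.Full
  faithful_t : t.Faithful
  isZero_iff : ∀ X : A, IsZero (j.obj X) ↔ i.essImage X

/-- A recollement of abelian categories `A' → A → A''` with a prescribed functor `i : A' ⥤ A`. -/
structure Recollement (i : A' ⥤ A) (A'' : Type u₃) [Category.{v₃} A''] [Abelian A''] where
  /-- The left adjoint `i^*` of `i`. -/
  iLeft : A ⥤ A'
  /-- The right adjoint `i^!` of `i`. -/
  iRight : A ⥤ A'
  /-- The quotient functor `j^! = j^*`. -/
  j : A ⥤ A''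
  /-- The left adjoint `j_!` of the quotient functor. -/
  jLeft : A'' ⥤ A
  /-- The right adjoint `j_*` of the quotient functor. -/
  jRight : A'' ⥤ A
  loc : LocalisationSequence i iRight j jRight
  coloc : ColocalisationSequence i iLeft j jLeft

/-- An exact functor is a homological embedding if it induces isomorphisms on all Ext groups. -/
def IsHomologicalEmbedding (i : A' ⥤ A) (hi : IsExactFunctor i) : Prop :=
  letI : HasExt.{max u₁ v₁} A' := HasExt.standard A'
  letI : HasExt.{max u₂ v₂} A := HasExt.standard A
  haveI := hi.additive
  haveI := hi.preservesFiniteLimits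
  haveI := hi.preservesFiniteColimits
  ∀ (X Y : A') (p : ℕ), Function.Bijective
    (i.mapExtAddHom X Y p :
      Ext.{max u₁ v₁} X Y p →+ Ext.{max u₂ v₂} (i.obj X) (i.obj Y) p)

/-- A recollement is homological if `i` induces isomorphisms on all Ext groups. -/
def Recollement.IsHomological {i : A' ⥤ A} (R : Recollement i A'') : Prop :=
  IsHomologicalEmbedding i R.loc.exact_i

end Recollements

/-- A ring is finitely generated as a right module over itself. -/
theorem finite_right_self (R : Type v) [Ring R] : Module.Finite Rᵐᵒᵖ R :=
  ⟨⟨{1}, by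
    rw [eq_top_iff]
    intro x _
    rw [Finset.coe_singleton, Submodule.mem_span_singleton]
    exact ⟨MulOpposite.op x, by simp⟩⟩⟩

/-- A chain `0 = A₀ ⊆ A₁ ⊆ ⋯ ⊆ Aₙ = A` of full (isomorphism-closed) subcategories, abelian as
categories, with division rings `Γ₁, …, Γₙ` and homological recollements of abelian categories
`A_{i-1} → A_i → mod Γ_i` extending the inclusions. Here `mod Γ_i` is the category of finitely
generated right `Γ_i`-modules. The number `i ∈ {1, …, n}` corresponds to the element `i - 1` of
`Fin n`. -/
structure RecollementChain (A : Type u) [Category.{v} A] [Abelian A] (n : ℕ) where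
  sub : Fin (n + 1) → ObjectProperty A
  closedUnderIso : ∀ k, (sub k).IsClosedUnderIsomorphisms
  le_succ : ∀ i : Fin n, sub i.castSucc ≤ sub i.succ
  sub_zero : ∀ X, sub 0 X ↔ IsZero X
  sub_last : ∀ X, sub (Fin.last n) X
  isAbelian : ∀ k, IsAbelianCategory (sub k).FullSubcategory
  Γ : Fin n → Type v
  divisionRing : ∀ i, DivisionRing (Γ i)
  recollement : ∀ i : Fin n,
    Recollement (ObjectProperty.ιOfLE (le_succ i)) (FGModuleCat.{v} (Γ i)ᵐᵒᵖ)
  isHomological : ∀ i, (recollement i).IsHomological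

attribute [instance] RecollementChain.isAbelian RecollementChain.divisionRing

namespace RecollementChain

variable {A : Type u} [Category.{v} A] [Abelian A] {n : ℕ} (C : RecollementChain A n)

/-- The object `Δ_i` of `A_i ⊆ A`: the image of the right module `Γ_i` under the left adjoint
`mod Γ_i ⥤ A_i` of the quotient functor `A_i ⥤ mod Γ_i`. -/
def standardObject (i : Fin n) : A :=
  haveI := finite_right_self (C.Γ i)
  ((C.recollement i).jLeft.obj (FGModuleCat.of (C.Γ i)ᵐᵒᵖ (C.Γ i))).obj

end RecollementChain

end

end HighestWeight

/-! Write A_{i-1} ⊆ A_i for two consecutive terms of the chain. Both directions rest on one picture: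
Δ_i is projective in A_i, its nonzero endomorphisms are invertible, A_{i-1} consists of the objects
X of A_i with Hom(Δ_i, X) = 0, and the quotient functor A_i → mod Γ_i is essentially Hom(Δ_i, -).

From a chain to standard objects: A_{i-1} is the kernel of an exact functor on A_i, so descending
induction makes every A_i a Serre subcategory of A. The left adjoint j_! is fully faithful and
preserves projectives, which gives the properties of Δ_i = j_!(Γ_i) inside A_i. It remains to lift
Δ_i to a projective of A. A projective P' of A_{l-1} satisfies Ext^p(P', X) = 0 in A_l for X in
A_{l-1} and p > 0, because the recollement is homological. The universal extension of P' by copies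
of Δ_l is then projective in A_l (`exists_projective_universal_extension`). It exists because
Ext^1(P', Δ_l) is finitely generated over End(Δ_l), and this is where Ext-finiteness of A enters.
Iterating up to A adds only factors Δ_l with l > i (`RecollementChain.exists_projective`).

From standard objects to a chain: A_k is defined by the vanishing of maps from the later Δ_j,
equivalently from the later P_j, hence is a Serre subcategory. A projective generator of A_i
filtered by Δ_1, …, Δ_i has a subobject filtered by copies of Δ_i whose quotient is a projective
generator of A_{i-1} (`exists_generator_castSucc`). This sequence is a projective resolution of
length one in A_i, and it shows that A_{i-1} → A_i is homological. In the recollement, the adjoints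
of the inclusion are the quotient by the trace of Δ_i and the largest subobject without maps from
Δ_i, and j_! sends a module of dimension r to Δ_i^r.

The hard adjoint is j_*. A pair (Y, jY → M) in which no nonzero subobject of Y is killed is called
reduced; a reduced pair of maximal length is couniversal (`isLeftAdjoint_of_isReduced_bounded`).
That the lengths are bounded (`len_bounded_of_isReduced`) follows from `exists_length_bound`,
applied in the opposite category, and uses Ext-finiteness of A^op. -/

namespace HighestWeight

noncomputable section

attribute [local instance] CategoryTheory.Abelian.hasFiniteBiproducts

open ZeroObject

/-! ### Short exact sequences, and adjoints from universal arrows. -/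

section Tools

variable {A : Type u} [Category.{v} A] [Abelian A]

theorem shortExact_kernel {X Y : A} (p : X ⟶ Y) [Epi p] :
    (ShortComplex.mk (kernel.ι p) p (kernel.condition p)).ShortExact :=
  { exact := ShortComplex.exact_kernel p }

theorem shortExact_cokernel {X Y : A} (m : X ⟶ Y) [Mono m] :
    (ShortComplex.mk m (cokernel.π m) (cokernel.condition m)).ShortExact :=
  { exact := ShortComplex.exact_cokernel m }

theorem shortExact_of_comp_iso {S : ShortComplex A} (hS : S.ShortExact) {X₁ X₂ X₃ : A}
    (e₁ : X₁ ≅ S.X₁) (e₂ : X₂ ≅ S.X₂) (e₃ : X₃ ≅ S.X₃) :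
    (ShortComplex.mk (e₁.hom ≫ S.f ≫ e₂.inv) (e₂.hom ≫ S.g ≫ e₃.inv)
      (by simp)).ShortExact :=
  ShortComplex.shortExact_of_iso
    (ShortComplex.isoMk e₁ e₂ e₃ (by simp) (by simp) :
      ShortComplex.mk (e₁.hom ≫ S.f ≫ e₂.inv) (e₂.hom ≫ S.g ≫ e₃.inv) (by simp) ≅ S).symm hS

/-- The short exact sequence `0 → ker a → ker (a ≫ b) → ker b → 0` for an epimorphism `a`. -/
theorem exists_shortExact_kernel_comp {X Y Z : A} (a : X ⟶ Y) (b : Y ⟶ Z) [Epi a] :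
    ∃ S : ShortComplex A, S.ShortExact ∧ S.X₁ = kernel a ∧ S.X₂ = kernel (a ≫ b) ∧
      S.X₃ = kernel b := by
  let f : kernel a ⟶ kernel (a ≫ b) := kernel.lift _ (kernel.ι a) (by simp)
  let g : kernel (a ≫ b) ⟶ kernel b := kernel.lift _ (kernel.ι _ ≫ a) (by simp)
  have w : f ≫ g = 0 := by
    rw [← cancel_mono (kernel.ι b)]
    simp [f, g]
  have : Mono f := mono_of_mono_fac (show f ≫ kernel.ι _ = kernel.ι a by simp [f])
  -- The kernel of the composite is the preimage of `kernel b` under `a`; epimorphisms are stable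
  -- under pullback, so `g` is epi.
  have sq : IsPullback g (kernel.ι (a ≫ b)) (kernel.ι b) a := by
    refine ⟨⟨by simp [g]⟩, ⟨PullbackCone.IsLimit.mk _
      (fun s => kernel.lift _ s.snd ?_) (fun s => ?_) (fun s => ?_) (fun s m h₁ h₂ => ?_)⟩⟩
    · rw [← Category.assoc, ← s.condition]; simp
    · rw [← cancel_mono (kernel.ι b)]
      simp [g, s.condition]
    · simp
    · rw [← cancel_mono (kernel.ι (a ≫ b))]
      simp [h₂]
  have : Epi g := by
    have := Abelian.epi_fst_of_isLimit (f := kernel.ι b) (g := a) (s := sq.cone) sq.isLimit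
    exact this
  refine ⟨ShortComplex.mk f g w, { exact := ?_ }, rfl, rfl, rfl⟩
  apply ShortComplex.exact_of_f_is_kernel
  refine KernelFork.IsLimit.ofι' f w fun {T} k hk => ⟨kernel.lift _ (k ≫ kernel.ι _) ?_, ?_⟩
  · have := congr($hk ≫ kernel.ι b)
    simpa [g] using this
  · rw [← cancel_mono (kernel.ι (a ≫ b))]
    simp [f]

/-- Take for `W` the preimage in `S.X₂` of the subobject `T.X₁` of the quotient. This permits
induction on a filtration of the quotient of an extension. -/
theorem exists_shortExact_refinement {S T : ShortComplex A} (hS : S.ShortExact)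
    (hT : T.ShortExact) (e : T.X₂ ≅ S.X₃) :
    ∃ (W : A) (f : S.X₁ ⟶ W) (g : W ⟶ T.X₁) (w : f ≫ g = 0) (f' : W ⟶ S.X₂) (g' : S.X₂ ⟶ T.X₃)
      (w' : f' ≫ g' = 0), (ShortComplex.mk f g w).ShortExact ∧
        (ShortComplex.mk f' g' w').ShortExact := by
  have := hS.epi_g
  have := hT.epi_g
  have := hS.mono_f
  have := hT.mono_f
  obtain ⟨R, hR, e₁, e₂, e₃⟩ := exists_shortExact_kernel_comp S.g (e.inv ≫ T.g)
  have i₁ : S.X₁ ≅ R.X₁ :=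
    IsLimit.conePointUniqueUpToIso hS.fIsKernel (kernelIsKernel S.g) ≪≫ eqToIso e₁.symm
  have i₃ : T.X₁ ≅ R.X₃ :=
    IsLimit.conePointUniqueUpToIso hT.fIsKernel (kernelIsKernel T.g) ≪≫
      (kernelIsIsoComp e.inv T.g).symm ≪≫ eqToIso e₃.symm
  exact ⟨_, _, _, _, _, _, _, shortExact_of_comp_iso hR i₁ (eqToIso e₂.symm) i₃,
    shortExact_kernel (S.g ≫ e.inv ≫ T.g)⟩

/-- A functor for which every object admits a universal arrow is a right adjoint. -/
theorem isRightAdjoint_of_exists_universal {C : Type u₁} [Category.{v₁} C] {D : Type u₂}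
    [Category.{v₂} D] (G : D ⥤ C)
    (h : ∀ X : C, ∃ (L : D) (η : X ⟶ G.obj L), ∀ (Y : D) (f : X ⟶ G.obj Y),
      ∃! g : L ⟶ Y, η ≫ G.map g = f) : G.IsRightAdjoint := by
  have (X : C) : HasInitial (StructuredArrow X G) := by
    obtain ⟨L, η, hη⟩ := h X
    refine IsInitial.hasInitial (X := StructuredArrow.mk η) (IsInitial.ofUniqueHom
      (fun Z => StructuredArrow.homMk (hη _ Z.hom).choose (hη _ Z.hom).choose_spec.1) ?_)
    intro Z m
    ext
    exact (hη _ Z.hom).choose_spec.2 _ (StructuredArrow.w m)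
  exact isRightAdjointOfStructuredArrowInitials G

/-- A functor for which every object admits a couniversal arrow is a left adjoint. -/
theorem isLeftAdjoint_of_exists_universal {C : Type u₁} [Category.{v₁} C] {D : Type u₂}
    [Category.{v₂} D] (G : D ⥤ C)
    (h : ∀ X : C, ∃ (L : D) (η : G.obj L ⟶ X), ∀ (Y : D) (f : G.obj Y ⟶ X),
      ∃! g : Y ⟶ L, G.map g ≫ η = f) : G.IsLeftAdjoint := by
  have (X : C) : HasTerminal (CostructuredArrow G X) := by
    obtain ⟨L, η, hη⟩ := h X
    refine IsTerminal.hasTerminal (X := CostructuredArrow.mk η) (IsTerminal.ofUniqueHom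
      (fun Z => CostructuredArrow.homMk (hη _ Z.hom).choose (hη _ Z.hom).choose_spec.1) ?_)
    intro Z m
    ext
    exact (hη _ Z.hom).choose_spec.2 _ (CostructuredArrow.w m)
  exact isLeftAdjoint_of_costructuredArrowTerminals G

end Tools

/-! ### Objects with a filtration. -/

section Filtrations

variable {A : Type u} [Category.{v} A] [Abelian A]

theorem Filt.of_iso {Q : ObjectProperty A} {X Y : A} (e : X ≅ Y) (h : Filt Q X) : Filt Q Y := by
  induction h with
  | zero X hX => exact .zero _ (hX.of_iso e.symm)
  | step S hS h₁ h₃ _ =>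
    exact .step _ (shortExact_of_comp_iso hS (Iso.refl _) e.symm (Iso.refl _)) h₁ h₃

theorem Filt.mono {Q Q' : ObjectProperty A} (hQ : ∀ X, Q X → Q' X) {X : A} (h : Filt Q X) :
    Filt Q' X := by
  induction h with
  | zero X hX => exact .zero _ hX
  | step S hS h₁ h₃ ih => exact .step S hS ih (hQ _ h₃)

theorem Filt.of_prop {Q : ObjectProperty A} {X : A} (h : Q X) : Filt Q X :=
  .step (ShortComplex.mk (0 : (0 : A) ⟶ X) (𝟙 X) (by simp))
    { exact := (ShortComplex.exact_iff_mono _ (by simp)).2 inferInstance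
      mono_f := ⟨fun _ _ _ => (isZero_zero A).eq_of_tgt _ _⟩ }
    (.zero _ (isZero_zero A)) h

theorem Filt.extension {Q : ObjectProperty A} {S : ShortComplex A} (hS : S.ShortExact)
    (h₁ : Filt Q S.X₁) (h₃ : Filt Q S.X₃) : Filt Q S.X₂ := by
  obtain ⟨Z, hZ⟩ : ∃ Z, Z = S.X₃ := ⟨_, rfl⟩
  rw [← hZ] at h₃
  induction h₃ generalizing S with
  | zero X hX =>
    subst hZ
    have := hS.isIso_f_iff.2 hX
    exact h₁.of_iso (asIso S.f)
  | step T hT _ hT₃ ih =>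
    obtain ⟨W, f, g, w, f', g', w', h, h'⟩ := exists_shortExact_refinement hS hT (eqToIso hZ)
    exact .step (.mk f' g' w') h' (ih h h₁ rfl) hT₃

theorem Filt.prop {Q P : ObjectProperty A} [P.IsSerreClass] (hQ : ∀ X, Q X → P X) {X : A}
    (h : Filt Q X) : P X := by
  induction h with
  | zero X hX => exact P.prop_of_isZero hX
  | step S hS h₁ h₃ ih => exact P.prop_X₂_of_shortExact hS ih (hQ _ h₃)

theorem Filt.map {B : Type u₂} [Category.{v₂} B] [Abelian B] (F : A ⥤ B) (hF : IsExactFunctor F)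
    {Q : ObjectProperty A} {Q' : ObjectProperty B} (hQ : ∀ X, Q X → Q' (F.obj X)) {X : A}
    (h : Filt Q X) : Filt Q' (F.obj X) := by
  have := hF.additive
  have := hF.preservesFiniteLimits
  have := hF.preservesFiniteColimits
  induction h with
  | zero X hX => exact .zero _ (F.map_isZero hX)
  | step S hS h₁ h₃ ih => exact .step _ (hS.map_of_exact F) ih (hQ _ h₃)

end Filtrations

/-! ### Lengths of composition series, without Jordan–Hölder. -/

section Length

variable {A : Type u} [Category.{v} A] [Abelian A]

/-- `HasLength X n`: the object `X` has a composition series with `n` factors. -/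
inductive HasLength : A → ℕ → Prop
  | zero (X : A) (hX : IsZero X) : HasLength X 0
  | step (S : ShortComplex A) (hS : S.ShortExact) {n : ℕ} (h₁ : HasLength S.X₁ n)
      (h₃ : Simple S.X₃) : HasLength S.X₂ (n + 1)

theorem HasLength.of_iso {X Y : A} (e : X ≅ Y) {n : ℕ} (h : HasLength X n) : HasLength Y n := by
  cases h with
  | zero _ hX => exact .zero _ (hX.of_iso e.symm)
  | step S hS h₁ h₃ =>
    exact .step _ (shortExact_of_comp_iso hS (Iso.refl _) e.symm (Iso.refl _)) h₁ h₃

theorem HasLength.filt {X : A} {n : ℕ} (h : HasLength X n) : Filt (fun S => Simple S) X := by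
  induction h with
  | zero X hX => exact .zero _ hX
  | step S hS _ h₃ ih => exact .step S hS ih h₃

theorem exists_hasLength {X : A} (h : Filt (fun S => Simple S) X) : ∃ n, HasLength X n := by
  induction h with
  | zero X hX => exact ⟨0, .zero _ hX⟩
  | step S hS _ h₃ ih =>
    obtain ⟨n, hn⟩ := ih
    exact ⟨n + 1, .step S hS hn h₃⟩

theorem HasLength.extension {S : ShortComplex A} (hS : S.ShortExact) {a b : ℕ}
    (h₁ : HasLength S.X₁ a) (h₃ : HasLength S.X₃ b) : HasLength S.X₂ (a + b) := by
  obtain ⟨Z, hZ⟩ : ∃ Z, Z = S.X₃ := ⟨_, rfl⟩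
  rw [← hZ] at h₃
  induction h₃ generalizing S with
  | zero X hX =>
    subst hZ
    have := hS.isIso_f_iff.2 hX
    exact h₁.of_iso (asIso S.f)
  | step T hT _ hT₃ ih =>
    obtain ⟨W, f, g, w, f', g', w', h, h'⟩ := exists_shortExact_refinement hS hT (eqToIso hZ)
    exact .step (.mk f' g' w') h' (ih h h₁ rfl) hT₃

/-- The image of a map to a simple object is zero or everything. -/
theorem eq_zero_or_epi_of_simple {X S : A} [Simple S] (f : X ⟶ S) : f = 0 ∨ Epi f := by
  by_cases h : f = 0
  · exact .inl h
  · exact .inr (epi_of_nonzero_to_simple h)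

/-- Subobjects of an object of length `n` have length at most `n`, and proper ones have
smaller length. -/
theorem HasLength.of_mono {X Y : A} {n : ℕ} (h : HasLength X n) (m : Y ⟶ X) [Mono m] :
    ∃ k ≤ n, HasLength Y k ∧ (k = n → IsIso m) := by
  induction h generalizing Y with
  | zero X hX =>
    have hY : IsZero Y := IsZero.of_mono m hX
    exact ⟨0, le_rfl, .zero _ hY, fun _ => ⟨0, hY.eq_of_tgt _ _, hX.eq_of_tgt _ _⟩⟩
  | step S hS h₁ h₃ ih =>
    rename_i n
    have := hS.mono_f
    have := hS.epi_g
    let i : kernel (m ≫ S.g) ⟶ S.X₁ := hS.fIsKernel.lift (KernelFork.ofι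
      (kernel.ι (m ≫ S.g) ≫ m) (by simp))
    have hi : i ≫ S.f = kernel.ι (m ≫ S.g) ≫ m :=
      hS.fIsKernel.fac (KernelFork.ofι (kernel.ι (m ≫ S.g) ≫ m) (by simp)) .zero
    have : Mono i := mono_of_mono_fac (h := kernel.ι (m ≫ S.g) ≫ m) hi
    obtain ⟨k, hk, hkl, hiso⟩ := ih i
    rcases eq_zero_or_epi_of_simple (m ≫ S.g) with h0 | hepi
    · refine ⟨k, by omega, hkl.of_iso ?_, fun h => by omega⟩
      exact kernelIsoOfEq h0 ≪≫ kernelZeroIsoSource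
    · refine ⟨k + 1, by omega, .step _ (shortExact_kernel (m ≫ S.g)) hkl h₃, fun h => ?_⟩
      have := hiso (by omega)
      let φ : ShortComplex.mk _ _ (kernel.condition (m ≫ S.g)) ⟶ S :=
        { τ₁ := i, τ₂ := m, τ₃ := 𝟙 _, comm₁₂ := hi, comm₂₃ := by simp }
      exact ShortComplex.isIso₂_of_shortExact_of_isIso₁₃ φ (shortExact_kernel (m ≫ S.g)) hS

/-- Quotients of an object of length `n` have length at most `n`. -/
theorem HasLength.of_epi {X Y : A} {n : ℕ} (h : HasLength X n) (p : X ⟶ Y) [Epi p] :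
    ∃ k ≤ n, HasLength Y k := by
  induction h generalizing Y with
  | zero X hX => exact ⟨0, le_rfl, .zero _ (IsZero.of_epi p hX)⟩
  | step S hS h₁ h₃ ih =>
    rename_i n
    have := hS.epi_g
    obtain ⟨k, hk, hkl⟩ := ih (Limits.factorThruImage (S.f ≫ p))
    let q := cokernel.π (Limits.image.ι (S.f ≫ p))
    let t : S.X₃ ⟶ cokernel (Limits.image.ι (S.f ≫ p)) := hS.gIsCokernel.desc
      (CokernelCofork.ofπ (p ≫ q)
      (by
        have := congr($(Limits.image.fac (S.f ≫ p)) ≫ q)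
        rw [Category.assoc, cokernel.condition, comp_zero, Category.assoc] at this
        exact this.symm))
    have ht : S.g ≫ t = p ≫ q := hS.gIsCokernel.fac (CokernelCofork.ofπ (p ≫ q) _) .one
    have : Epi t := epi_of_epi_fac ht
    have key := shortExact_cokernel (Limits.image.ι (S.f ≫ p))
    by_cases h0 : t = 0
    · refine ⟨k, by omega, hkl.of_iso ?_⟩
      have hz : IsZero (cokernel (Limits.image.ι (S.f ≫ p))) := by
        rw [IsZero.iff_id_eq_zero, ← cancel_epi t, h0, zero_comp, zero_comp]
      have : IsIso (Limits.image.ι (S.f ≫ p)) := key.isIso_f_iff.2 hz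
      exact asIso (Limits.image.ι (S.f ≫ p))
    · have := isIso_of_epi_of_nonzero h0
      exact ⟨k + 1, by omega, .step _ key hkl (Simple.of_iso (asIso t).symm)⟩

/-- The smallest number of factors of a composition series. -/
def len (X : A) : ℕ := sInf {n | HasLength X n}

theorem hasLength_len (hA : IsLengthCategory A) (X : A) : HasLength X (len X) :=
  Nat.sInf_mem (exists_hasLength (hA X))

theorem HasLength.len_le {X : A} {n : ℕ} (h : HasLength X n) : len X ≤ n := Nat.sInf_le h

theorem len_le_of_mono (hA : IsLengthCategory A) {X Y : A} (m : Y ⟶ X) [Mono m] :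
    len Y ≤ len X := by
  obtain ⟨k, hk, hl, -⟩ := (hasLength_len hA X).of_mono m
  exact hl.len_le.trans hk

/-- A proper subobject has a strictly shorter composition series. All later maximality arguments end
with this. -/
theorem isIso_of_mono_of_len_le (hA : IsLengthCategory A) {X Y : A} (m : Y ⟶ X) [Mono m]
    (h : len X ≤ len Y) : IsIso m := by
  obtain ⟨k, hk, hl, hiso⟩ := (hasLength_len hA X).of_mono m
  have := hl.len_le
  exact hiso (by omega)

/-- Among the subobjects of `X` in a class `Φ` of maps to `X` which is closed under sums and
images there is a largest one. -/
theorem exists_largest_mono (hA : IsLengthCategory A) (X : A) (Φ : ∀ K : A, (K ⟶ X) → Prop)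
    (h0 : Φ 0 0) (hsum : ∀ K L (f : K ⟶ X) (g : L ⟶ X), Φ K f → Φ L g → Φ (K ⊞ L) (biprod.desc f g))
    (hepi : ∀ K L (e : K ⟶ L) (f : L ⟶ X), Epi e → Φ K (e ≫ f) → Φ L f) :
    ∃ (K : A) (k : K ⟶ X), Mono k ∧ Φ K k ∧ ∀ L (f : L ⟶ X), Φ L f → ∃ g, g ≫ k = f := by
  let N : Set ℕ := {n | ∃ (K : A) (k : K ⟶ X), Mono k ∧ Φ K k ∧ len K = n}
  have hN : N.Nonempty := ⟨_, 0, 0, ⟨fun _ _ _ => (isZero_zero A).eq_of_tgt _ _⟩, h0, rfl⟩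
  have hb : BddAbove N := ⟨len X, by
    rintro n ⟨K, k, _, -, rfl⟩
    exact len_le_of_mono hA k⟩
  obtain ⟨K, k, hk, hΦ, hlen⟩ := Nat.sSup_mem hN hb
  refine ⟨K, k, hk, hΦ, fun L f hf => ?_⟩
  -- The image of `d` is the sum of `K` and the image of `f`; it contains `K`, so maximal length
  -- forces equality and `f` factors through `k`.
  let d := biprod.desc k f
  have hd : Φ _ (Limits.image.ι d) := by
    apply hepi _ _ (Limits.factorThruImage d) _ inferInstance
    rw [Limits.image.fac]
    exact hsum _ _ _ _ hΦ hf
  have hle : len (Limits.image d) ≤ len K := by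
    rw [hlen]
    exact le_csSup hb ⟨_, _, inferInstance, hd, rfl⟩
  let i : K ⟶ Limits.image d := biprod.inl ≫ Limits.factorThruImage d
  have hi : i ≫ Limits.image.ι d = k := by simp [i, d]
  have : Mono i := mono_of_mono_fac hi
  have := isIso_of_mono_of_len_le hA i hle
  refine ⟨biprod.inr ≫ Limits.factorThruImage d ≫ inv i, ?_⟩
  rw [← hi]
  simp [d]

/-- A nonzero object of finite length has a simple quotient. -/
theorem exists_simple_quotient {X : A} (h : Filt (fun S => Simple S) X) (hX : ¬ IsZero X) :
    ∃ (S : A) (p : X ⟶ S), Simple S ∧ Epi p := by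
  cases h with
  | zero _ h0 => exact (hX h0).elim
  | step S hS h₁ h₃ => exact ⟨S.X₃, S.g, h₃, hS.epi_g⟩

end Length

end

end HighestWeight

namespace HighestWeight

noncomputable section

/-! ### Ext¹ and short exact sequences; inheritance of Ext-finiteness. -/

section Realization

variable {A : Type u} [Category.{v} A] [Abelian A]

open Pretriangulated DerivedCategory in
/-- Every element of `Ext¹` is the class of a short exact sequence. -/
theorem exists_extClass_eq [HasExt.{max u v} A] {X Y : A} (x : Ext.{max u v} X Y 1) :
    ∃ (E : A) (f : Y ⟶ E) (g : E ⟶ X) (w : f ≫ g = 0)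
      (hS : (ShortComplex.mk f g w).ShortExact), hS.extClass = x := by
  let _ := HasDerivedCategory.standard A
  let δ : (singleFunctor A 0).obj X ⟶ ((singleFunctor A 0).obj Y)⟦(1 : ℤ)⟧ := x.hom
  obtain ⟨Z, f', g', hT'⟩ := distinguished_cocone_triangle₂ δ
  -- The middle term of the triangle with connecting map `δ` is an extension of two objects in
  -- degree 0, hence itself lies in the heart of the t-structure.
  have : Z.IsLE 0 := TStructure.t.isLE₂ _ hT' 0
    (inferInstanceAs (((singleFunctor A 0).obj Y).IsLE 0))
    (inferInstanceAs (((singleFunctor A 0).obj X).IsLE 0))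
  have : Z.IsGE 0 := TStructure.t.isGE₂ _ hT' 0
    (inferInstanceAs (((singleFunctor A 0).obj Y).IsGE 0))
    (inferInstanceAs (((singleFunctor A 0).obj X).IsGE 0))
  obtain ⟨E, ⟨e⟩⟩ := exists_iso_singleFunctor_obj_of_isGE_of_isLE Z 0
  obtain ⟨f, hf⟩ := (singleFunctor A 0).map_surjective (f' ≫ e.hom)
  obtain ⟨g, hg⟩ := (singleFunctor A 0).map_surjective (e.inv ≫ g')
  have hT : Triangle.mk ((singleFunctor A 0).map f) ((singleFunctor A 0).map g) δ ∈
      distTriang (DerivedCategory A) := by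
    refine isomorphic_distinguished _ hT' _
      (Triangle.isoMk _ _ (Iso.refl _) e.symm (Iso.refl _) ?_ ?_ ?_)
    · change (singleFunctor A 0).map f ≫ e.inv = 𝟙 _ ≫ f'
      simp [hf]
    · change (singleFunctor A 0).map g ≫ 𝟙 _ = e.inv ≫ g'
      simp [hg]
    · change δ ≫ (𝟙 _)⟦(1 : ℤ)⟧' = 𝟙 _ ≫ δ
      simp
  have w : f ≫ g = 0 := (singleFunctor A 0).map_injective (by
    rw [Functor.map_comp, Functor.map_zero]
    exact comp_distTriang_mor_zero₁₂ _ hT)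
  let S := ShortComplex.mk f g w
  let α := singleFunctorCompHomologyFunctorIso A 0
  have hS : S.ShortExact := by
    have hS' : (S.map (singleFunctor A 0 ⋙ homologyFunctor A 0)).ShortExact :=
      { exact := HomologySequence.exact₂ _ hT 0
        mono_f := (HomologySequence.mono_homologyMap_mor₁_iff _ hT (-1) 0).2
          ((isZero_of_isGE ((singleFunctor A 0).obj X) 0 (-1) (by lia)).eq_of_src _ _)
        epi_g := (HomologySequence.epi_homologyMap_mor₂_iff _ hT 0 1).2
          ((isZero_of_isLE ((singleFunctor A 0).obj Y) 0 1 (by lia)).eq_of_tgt _ _) }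
    exact ShortComplex.shortExact_of_iso (S.mapNatIso α) hS'
  have hep : Epi g := hS.epi_g
  refine ⟨E, f, g, w, hS, ?_⟩
  -- The triangle of the short exact sequence and the one with connecting map `δ` share two maps;
  -- the comparison on the third vertex is the identity because `g` is epi, so the connecting maps
  -- agree.
  obtain ⟨c, hc, hc'⟩ := complete_distinguished_triangle_morphism _ _
    hS.singleTriangle_distinguished hT (𝟙 _) (𝟙 _) (by
      change (singleFunctor A 0).map f ≫ 𝟙 _ = 𝟙 _ ≫ (singleFunctor A 0).map f; simp)
  obtain ⟨c, rfl⟩ := (singleFunctor A 0).map_surjective c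
  have h1 : g ≫ c = g := (singleFunctor A 0).map_injective (by
    rw [Functor.map_comp]
    refine hc.trans ?_
    exact Category.id_comp _)
  have h2 : c = 𝟙 _ := by
    rw [← cancel_epi g, h1]
    exact (Category.comp_id g).symm
  ext
  rw [hS.extClass_hom]
  subst h2
  have h3 : hS.singleδ ≫ (𝟙 ((singleFunctor A 0).obj Y))⟦(1 : ℤ)⟧' =
    (singleFunctor A 0).map (𝟙 X) ≫ δ := hc'
  rw [CategoryTheory.Functor.map_id, CategoryTheory.Functor.map_id, Category.comp_id,
    Category.id_comp] at h3
  exact h3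

/-- The class of a short exact sequence which splits is zero. -/
theorem extClass_eq_zero_of_section [HasExt.{max u v} A] {S : ShortComplex A} (hS : S.ShortExact)
    (s : S.X₃ ⟶ S.X₂) (hs : s ≫ S.g = 𝟙 _) : hS.extClass = 0 := by
  have h := hS.comp_extClass
  rw [← Ext.mk₀_id_comp hS.extClass, ← hs, ← Ext.mk₀_comp_mk₀_assoc, h, Ext.comp_zero]

theorem exists_section_of_extClass_eq_zero [HasExt.{max u v} A] {S : ShortComplex A}
    (hS : S.ShortExact) (h : hS.extClass = 0) : ∃ s : S.X₃ ⟶ S.X₂, s ≫ S.g = 𝟙 _ := by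
  obtain ⟨x, hx⟩ := Ext.covariant_sequence_exact₃ S.X₃ hS (Ext.mk₀ (𝟙 S.X₃)) (n₁ := 1) rfl
    (by rw [h, Ext.comp_zero])
  obtain ⟨s, rfl⟩ := (Ext.mk₀_bijective _ _).2 x
  rw [Ext.mk₀_comp_mk₀] at hx
  exact ⟨s, (Ext.mk₀_bijective _ _).1 hx⟩

theorem projective_of_ext_one_eq_zero [HasExt.{max u v} A] (P : A)
    (h : ∀ (Y : A) (x : Ext.{max u v} P Y 1), x = 0) : Projective P where
  factors {E X} f e _ := by
    obtain ⟨x, hx⟩ := Ext.covariant_sequence_exact₃ P (shortExact_kernel e) (Ext.mk₀ f) (n₁ := 1)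
      rfl (h _ _)
    obtain ⟨s, rfl⟩ := (Ext.mk₀_bijective _ _).2 x
    rw [Ext.mk₀_comp_mk₀] at hx
    exact ⟨s, (Ext.mk₀_bijective _ _).1 hx⟩

variable {B : Type u₂} [Category.{v₂} B] [Abelian B]

/-- A section of the image of an extension lifts along a fully faithful functor to a section of the
extension itself. -/
theorem mapExactFunctor_one_injective (F : A ⥤ B) [F.Full] [F.Faithful] [F.Additive]
    [PreservesFiniteLimits F] [PreservesFiniteColimits F] [HasExt.{max u v} A]
    [HasExt.{max u₂ v₂} B] {X Y : A} (x : Ext.{max u v} X Y 1)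
    (hx : (x.mapExactFunctor F : Ext.{max u₂ v₂} _ _ 1) = 0) : x = 0 := by
  obtain ⟨E, f, g, w, hS, rfl⟩ := exists_extClass_eq x
  rw [Ext.mapExactFunctor_extClass] at hx
  obtain ⟨s, hs⟩ := exists_section_of_extClass_eq_zero _ hx
  obtain ⟨s, rfl⟩ := F.map_surjective s
  exact extClass_eq_zero_of_section hS s (F.map_injective (by
    rw [F.map_comp, F.map_id]
    exact hs))

/-- Ext-finiteness is inherited along fully faithful exact functors which preserve simple
objects. -/
theorem ExtFinite.of_fullyFaithful {A B : Type u} [Category.{v} A] [Abelian A] [Category.{v} B]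
    [Abelian B] (F : A ⥤ B) [F.Full] [F.Faithful]
    (hF : IsExactFunctor F) (hs : ∀ S : A, Simple S → Simple (F.obj S)) (h : ExtFinite B) :
    ExtFinite A := by
  let _ : HasExt.{max u v} A := HasExt.standard A
  let _ : HasExt.{max u v} B := HasExt.standard B
  have := hF.additive
  have := hF.preservesFiniteLimits
  have := hF.preservesFiniteColimits
  intro S T hS hT
  have hS' := hs S hS
  have hT' := hs T hT
  let _ := extModuleEnd S T 1
  let _ := extModuleEnd (F.obj S) (F.obj T) 1
  have hfin : Module.Finite (End (F.obj T)) (Ext.{max u v} (F.obj S) (F.obj T) 1) :=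
    h _ _ (hs S hS) (hs T hT)
  let σ : End T →+* End (F.obj T) :=
    { toFun := fun f => F.map f
      map_one' := F.map_id T
      map_mul' := fun f g => F.map_comp g f
      map_zero' := F.map_zero _ _
      map_add' := fun f g => F.map_add }
  -- The image of Ext¹ is stable under `End (F.obj T)` because `F` is full. It is finitely
  -- generated, this ring being a division ring, and injectivity on Ext¹ transports generators back.
  let N : Submodule (End (F.obj T)) (Ext.{max u v} (F.obj S) (F.obj T) 1) :=
    { carrier := {y | ∃ x : Ext.{max u v} S T 1, x.mapExactFunctor F = y}
      add_mem' := by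
        rintro _ _ ⟨x, rfl⟩ ⟨y, rfl⟩
        exact ⟨x + y, by simp⟩
      zero_mem' := ⟨0, by simp⟩
      smul_mem' := by
        rintro c _ ⟨x, rfl⟩
        obtain ⟨c, rfl⟩ := F.map_surjective c
        refine ⟨x.comp (Ext.mk₀ c) (add_zero 1), ?_⟩
        rw [Ext.mapExactFunctor_comp, Ext.mapExactFunctor_mk₀]
        rfl }
  let _ : DivisionRing (End (F.obj T)) := inferInstance
  have hN : IsNoetherian (End (F.obj T)) (Ext.{max u v} (F.obj S) (F.obj T) 1) := inferInstance
  obtain ⟨s, hs⟩ := hN.noetherian N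
  choose! p hp using fun y (hy : y ∈ N) => hy
  classical
  refine ⟨⟨s.image p, ?_⟩⟩
  rw [eq_top_iff]
  intro x _
  have hx : x.mapExactFunctor F ∈ N := ⟨x, rfl⟩
  suffices H : ∀ y ∈ Submodule.span (End (F.obj T)) (s : Set (Ext.{max u v} (F.obj S) (F.obj T) 1)),
      ∃ x' ∈ Submodule.span (End T) ((s.image p : Finset _) : Set (Ext.{max u v} S T 1)),
        x'.mapExactFunctor F = y by
    obtain ⟨x', hx', h'⟩ := H _ (hs ▸ hx)
    have : x - x' = 0 := mapExactFunctor_one_injective F _ (by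
      have := (F.mapExtAddHom S T 1).map_sub x x'
      rw [Functor.mapExtAddHom_apply, Functor.mapExtAddHom_apply, Functor.mapExtAddHom_apply,
        h', sub_self] at this
      exact this)
    rw [sub_eq_zero.1 this]
    exact hx'
  intro y hy
  induction hy using Submodule.span_induction with
  | mem y hy =>
    exact ⟨p y, Submodule.subset_span (Finset.mem_coe.2 (Finset.mem_image_of_mem p hy)),
      hp y (hs ▸ Submodule.subset_span hy)⟩
  | zero => exact ⟨0, Submodule.zero_mem _, by simp⟩
  | add y z _ _ hy hz =>
    obtain ⟨a, ha, rfl⟩ := hy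
    obtain ⟨b, hb, rfl⟩ := hz
    exact ⟨a + b, Submodule.add_mem _ ha hb, by simp⟩
  | smul c y _ hy =>
    obtain ⟨a, ha, rfl⟩ := hy
    obtain ⟨c, rfl⟩ := F.map_surjective c
    refine ⟨a.comp (Ext.mk₀ c) (add_zero 1), Submodule.smul_mem _ (show End T from c) ha, ?_⟩
    rw [Ext.mapExactFunctor_comp, Ext.mapExactFunctor_mk₀]
    rfl

end Realization

/-! ### Serre subcategories inherit the hypotheses on the ambient category. -/

section SerreSubcategories

variable {A : Type u} [Category.{v} A] [Abelian A] (P : ObjectProperty A) [P.IsSerreClass]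

theorem isClosedUnderFiniteProducts_of_isSerreClass : P.IsClosedUnderFiniteProducts := by
  have : P.IsClosedUnderBinaryProducts :=
    { limitsOfShape_le := by
        rintro X ⟨p⟩
        refine P.prop_of_iso ?_ (P.prop_biprod (p.prop_diag_obj (.mk .left))
          (p.prop_diag_obj (.mk .right)))
        exact IsLimit.conePointUniqueUpToIso (BinaryBiproduct.isLimit _ _)
          ((IsLimit.postcomposeHomEquiv (diagramIsoPair p.diag) _).2 p.isLimit) }
  exact .mk'

instance isAbelianCategory_of_isSerreClass : IsAbelianCategory P.FullSubcategory := by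
  have := isClosedUnderFiniteProducts_of_isSerreClass P
  exact ⟨inferInstance, inferInstance, inferInstance, inferInstance, inferInstance⟩

theorem isExactFunctor_ι : IsExactFunctor P.ι where
  additive := inferInstance
  preservesFiniteLimits := by
    have := P.preservesKernels_ι
    exact Functor.preservesFiniteLimits_of_preservesKernels P.ι
  preservesFiniteColimits := by
    have := P.preservesCokernels_ι
    exact Functor.preservesFiniteColimits_of_preservesCokernels P.ι

theorem shortExact_of_map {B : Type u₂} [Category.{v₂} B] [Abelian B] (F : B ⥤ A) [F.Faithful]
    (hF : IsExactFunctor F) (S : ShortComplex B)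
    (h : haveI := hF.additive; (S.map F).ShortExact) : S.ShortExact := by
  have := hF.additive
  have := hF.preservesFiniteLimits
  have := hF.preservesFiniteColimits
  exact
    { exact := (S.exact_map_iff_of_faithful F).1 h.exact
      mono_f := F.mono_of_mono_map h.mono_f
      epi_g := F.epi_of_epi_map h.epi_g }

theorem isZero_of_isZero_map {B : Type u₂} [Category.{v₂} B] [HasZeroMorphisms B] {C : Type u₃}
    [Category.{v₃} C] (F : B ⥤ C) [F.Faithful] {X : B} (h : IsZero (F.obj X)) : IsZero X := by
  rw [IsZero.iff_id_eq_zero]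
  exact F.map_injective (h.eq_of_src _ _)

variable {P} in
theorem shortExact_homMk {X₁ X₂ X₃ : P.FullSubcategory} {f : X₁.obj ⟶ X₂.obj}
    {g : X₂.obj ⟶ X₃.obj} {w : f ≫ g = 0} (h : (ShortComplex.mk f g w).ShortExact) :
    (ShortComplex.mk (P.homMk f) (P.homMk g) (P.hom_ext w) :
      ShortComplex P.FullSubcategory).ShortExact :=
  shortExact_of_map P.ι (isExactFunctor_ι P) _ h

variable {P} in
theorem shortExact_hom {S : ShortComplex P.FullSubcategory} (h : S.ShortExact) :
    (ShortComplex.mk S.f.hom S.g.hom congr(($S.zero).hom)).ShortExact := by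
  have := (isExactFunctor_ι P).preservesFiniteLimits
  have := (isExactFunctor_ι P).preservesFiniteColimits
  exact h.map_of_exact P.ι

variable {P} in
theorem simple_obj_of_simple {X : P.FullSubcategory} (h : Simple X) : Simple X.obj where
  mono_isIso_iff_nonzero {Y} f hf := by
    let f' : (⟨Y, P.prop_of_mono f X.property⟩ : P.FullSubcategory) ⟶ X := P.homMk f
    have : Mono f' := P.ι.mono_of_mono_map (inferInstanceAs (Mono f))
    have key := Simple.mono_isIso_iff_nonzero f'
    constructor
    · intro hi h0
      have : IsIso (P.ι.map f') := hi
      exact key.1 (isIso_of_fully_faithful P.ι f') (P.hom_ext h0)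
    · intro h0
      have : IsIso f' := key.2 fun h => h0 congr(($h).hom)
      exact inferInstanceAs (IsIso (P.ι.map f'))

variable {P} in
theorem simple_of_simple_obj {X : P.FullSubcategory} (h : Simple X.obj) : Simple X := by
  have := (isExactFunctor_ι P).preservesFiniteLimits
  have : Simple (P.ι.obj X) := h
  exact Functor.simple_of_simple_obj P.ι X

variable {P} in
theorem filt_fullSubcategory {Q : ObjectProperty A} {X : P.FullSubcategory} (h : Filt Q X.obj) :
    Filt (fun Y : P.FullSubcategory => Q Y.obj) X := by
  obtain ⟨X, hX⟩ := X
  change Filt Q X at h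
  induction h with
  | zero X h0 => exact .zero _ (isZero_of_isZero_map P.ι h0)
  | step S hS h₁ h₃ ih =>
    have H := (P.prop_iff_of_shortExact hS).1 hX
    exact .step _ (shortExact_homMk (X₁ := ⟨S.X₁, H.1⟩) (X₂ := ⟨S.X₂, hX⟩) (X₃ := ⟨S.X₃, H.2⟩)
      (w := S.zero) hS) (ih H.1) h₃

theorem isLengthCategory_fullSubcategory (hA : IsLengthCategory A) :
    IsLengthCategory P.FullSubcategory := fun X =>
  (filt_fullSubcategory (hA X.obj)).mono fun _ h => simple_of_simple_obj h

theorem hasFinitelyManySimples_fullSubcategory (hA : HasFinitelyManySimples A) :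
    HasFinitelyManySimples P.FullSubcategory := by
  classical
  obtain ⟨m, S, hS⟩ := hA
  by_cases h : ∃ T : P.FullSubcategory, Simple T
  · obtain ⟨T₀, -⟩ := h
    refine ⟨m, fun i => if h : P (S i) then ⟨S i, h⟩ else T₀, fun T hT => ?_⟩
    obtain ⟨i, ⟨e⟩⟩ := hS T.obj (simple_obj_of_simple hT)
    have hi : P (S i) := P.prop_of_iso e T.property
    refine ⟨i, ⟨?_⟩⟩
    exact P.isoMk e ≪≫ eqToIso (dif_pos hi).symm
  · exact ⟨0, Fin.elim0, fun T hT => (h ⟨T, hT⟩).elim⟩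

theorem extFinite_fullSubcategory (hA : ExtFinite A) : ExtFinite P.FullSubcategory :=
  hA.of_fullyFaithful P.ι (isExactFunctor_ι P) fun _ h => simple_obj_of_simple h

theorem IsExactFunctor.op {B : Type u₂} [Category.{v₂} B] [Abelian B] {F : A ⥤ B}
    (hF : IsExactFunctor F) : IsExactFunctor F.op := by
  have := hF.additive
  have := hF.preservesFiniteLimits
  have := hF.preservesFiniteColimits
  exact ⟨inferInstance, preservesFiniteLimits_op F, preservesFiniteColimits_op F⟩

theorem simple_op {X : A} (h : Simple X) : Simple (Opposite.op X) where
  mono_isIso_iff_nonzero {Y} f hf := by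
    constructor
    · intro hi h0
      have : IsIso f.unop := inferInstance
      have h1 : f.unop = 0 := by rw [h0]; rfl
      rw [h1] at this
      exact id_nonzero X ((IsIso.hom_inv_id (0 : X ⟶ Y.unop)).symm.trans zero_comp)
    · intro h0
      have h1 : f.unop ≠ 0 := fun h => h0 (Quiver.Hom.unop_inj h)
      have : IsIso f.unop := isIso_of_epi_of_nonzero h1
      exact (isIso_unop_iff f).1 this

theorem simple_unop {X : Aᵒᵖ} (h : Simple X) : Simple X.unop where
  mono_isIso_iff_nonzero {Y} f hf := by
    constructor
    · intro hi h0
      have : IsIso f.op := inferInstance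
      have h1 : f.op = 0 := by rw [h0]; rfl
      rw [h1] at this
      exact id_nonzero X ((IsIso.hom_inv_id (0 : X ⟶ Opposite.op Y)).symm.trans zero_comp)
    · intro h0
      have h1 : f.op ≠ 0 := fun h => h0 (Quiver.Hom.op_inj h)
      have : IsIso f.op := isIso_of_epi_of_nonzero h1
      exact (isIso_op_iff f).1 this

theorem extFinite_op_fullSubcategory (hA : ExtFinite Aᵒᵖ) : ExtFinite P.FullSubcategoryᵒᵖ :=
  hA.of_fullyFaithful P.ι.op (isExactFunctor_ι P).op fun S h => by
    exact simple_op (simple_obj_of_simple (simple_unop h))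

end SerreSubcategories

end

end HighestWeight

namespace HighestWeight

noncomputable section

attribute [local instance] CategoryTheory.Abelian.hasFiniteBiproducts

/-! ### Ext groups as modules over the endomorphisms of the target. -/

section ExtModules

variable {A : Type u} [Category.{v} A] [Abelian A] [HasExt.{max u v} A]

attribute [local instance] extModuleEnd

theorem end_smul_ext {X S : A} {n : ℕ} (c : End S) (x : Ext.{max u v} X S n) :
    c • x = x.comp (Ext.mk₀ (End.asHom c)) (add_zero n) := rfl

/-- Precomposition with a class is linear over the endomorphism ring of the target. -/
def extPrecomp {X X' : A} (S : A) {n m k : ℕ} (α : Ext.{max u v} X' X n) (h : n + m = k) :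
    Ext.{max u v} X S m →ₗ[End S] Ext.{max u v} X' S k where
  toFun x := α.comp x h
  map_add' x y := Ext.comp_add _ _ _ _
  map_smul' c x := by
    simp only [end_smul_ext, RingHom.id_apply]
    rw [Ext.comp_assoc_of_third_deg_zero]

theorem range_extPrecomp_eq_ker {S : ShortComplex A} (hS : S.ShortExact) (Y : A) (n : ℕ) :
    LinearMap.range (extPrecomp Y (Ext.mk₀ S.g) (zero_add n)) =
      LinearMap.ker (extPrecomp Y (Ext.mk₀ S.f) (zero_add n)) := by
  ext x
  constructor
  · rintro ⟨y, rfl⟩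
    change (Ext.mk₀ S.f).comp ((Ext.mk₀ S.g).comp y (zero_add n)) (zero_add n) = 0
    rw [Ext.mk₀_comp_mk₀_assoc, S.zero, Ext.mk₀_zero, Ext.zero_comp]
  · intro hx
    exact Ext.contravariant_sequence_exact₂ hS Y x hx

theorem subsingleton_ext_of_isZero {X : A} (hX : IsZero X) (S : A) (n : ℕ) :
    Subsingleton (Ext.{max u v} X S n) :=
  ⟨fun x y => by
    rw [← Ext.mk₀_id_comp x, ← Ext.mk₀_id_comp y, hX.eq_of_src (𝟙 X) 0, Ext.mk₀_zero,
      Ext.zero_comp, Ext.zero_comp]⟩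

/-- Dévissage in the first variable only: the second stays simple, so the coefficients remain in one
division ring. -/
theorem finite_ext_of_filt {S : A} (hS : Simple S) (n : ℕ)
    (h : ∀ X : A, Simple X → Module.Finite (End S) (Ext.{max u v} X S n)) {X : A}
    (hX : Filt (fun S => Simple S) X) : Module.Finite (End S) (Ext.{max u v} X S n) := by
  induction hX with
  | zero X h0 =>
    have : Subsingleton (Ext.{max u v} X S n) := subsingleton_ext_of_isZero h0 S n
    infer_instance
  | step T hT h₁ h₃ ih =>
    have := h T.X₃ h₃
    have : IsNoetherian (End S) (Ext.{max u v} T.X₂ S n) :=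
      isNoetherian_of_range_eq_ker _ _ (range_extPrecomp_eq_ker hT S n)
    infer_instance

end ExtModules

/-! ### Universal extensions by a projective object. -/

section UniversalExtension

variable {B : Type u} [Category.{v} B] [Abelian B]

theorem isIso_of_ne_zero {Δ : B} (hΔ : ∀ x : End Δ, x ≠ 0 → IsUnit x) (x : Δ ⟶ Δ) (hx : x ≠ 0) :
    IsIso x :=
  (isUnit_iff_isIso x).1 (hΔ x hx)

theorem projective_biproduct {J : Type} [Finite J] (P : J → B) (h : ∀ j, Projective (P j)) :
    Projective (⨁ P) where
  factors f e _ := ⟨biproduct.desc fun j => Projective.factorThru (biproduct.ι P j ≫ f) e, by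
    ext j
    simp⟩

/-- If every nonzero endomorphism of `Δ` is invertible, there are no nonzero maps from `Δ` to
the kernel of a nonzero map out of `Δ`. -/
theorem hom_kernel_eq_zero {Δ X : B} (hΔ : ∀ x : End Δ, x ≠ 0 → IsUnit x) {p : Δ ⟶ X}
    (hp : p ≠ 0) (f : Δ ⟶ kernel p) : f = 0 := by
  by_contra hf
  have h0 : f ≫ kernel.ι p ≠ 0 := fun h => hf (by rwa [← cancel_mono (kernel.ι p), zero_comp])
  have := isIso_of_ne_zero hΔ _ h0
  have : Epi (kernel.ι p) := epi_of_epi f _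
  apply hp
  rw [← cancel_epi (kernel.ι p), kernel.condition, comp_zero]

attribute [local instance] extModuleEnd in
-- For a simple quotient π : Δ → S, the kernel of π receives no nonzero map from Δ, so by `hP'`
-- composition with π embeds Ext¹(P', Δ) into Ext¹(P', S), which is finite over End(S). Every
-- endomorphism of S lifts to the projective Δ, so the image is a submodule and its generators lift
-- to generators over End(Δ).
theorem exists_generators_ext_one [HasExt.{max u v} B] (hB : IsLengthCategory B)
    (hext : ExtFinite B) {Δ P' : B} [Projective Δ]
    (hΔ : Nontrivial (End Δ) ∧ ∀ x : End Δ, x ≠ 0 → IsUnit x)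
    (hP' : ∀ X : B, (∀ f : Δ ⟶ X, f = 0) → ∀ (p : ℕ) (x : Ext.{max u v} P' X (p + 1)), x = 0) :
    ∃ (r : ℕ) (x : Fin r → Ext.{max u v} P' Δ 1), ∀ y : Ext.{max u v} P' Δ 1,
      ∃ c : Fin r → (Δ ⟶ Δ), y = ∑ i, (x i).comp (Ext.mk₀ (c i)) (add_zero 1) := by
  have hΔ0 : ¬ IsZero Δ := fun h => by
    obtain ⟨a, b, hab⟩ := hΔ.1
    exact hab (h.eq_of_src _ _)
  obtain ⟨S, π, hS, hπ⟩ := exists_simple_quotient (hB Δ) hΔ0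
  have hπ0 : π ≠ 0 := fun h => by
    subst h
    exact id_nonzero S (by rw [← cancel_epi (0 : Δ ⟶ S)]; simp)
  have hfin := finite_ext_of_filt hS 1 (fun X hX => hext X S hX hS) (hB P')
  have hnoeth : IsNoetherian (End S) (Ext.{max u v} P' S 1) := inferInstance
  let N : Submodule (End S) (Ext.{max u v} P' S 1) :=
    { carrier := {y | ∃ x : Ext.{max u v} P' Δ 1, x.comp (Ext.mk₀ π) (add_zero 1) = y}
      add_mem' := by
        rintro _ _ ⟨x, rfl⟩ ⟨y, rfl⟩
        exact ⟨x + y, by simp⟩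
      zero_mem' := ⟨0, by simp⟩
      smul_mem' := by
        rintro c _ ⟨x, rfl⟩
        refine ⟨x.comp (Ext.mk₀ (Projective.factorThru (π ≫ End.asHom c) π)) (add_zero 1), ?_⟩
        rw [Ext.comp_assoc_of_third_deg_zero, Ext.mk₀_comp_mk₀, Projective.factorThru_comp,
          end_smul_ext, Ext.comp_assoc_of_third_deg_zero, Ext.mk₀_comp_mk₀] }
  obtain ⟨r, s, hs⟩ := Submodule.fg_iff_exists_fin_generating_family.1 (hnoeth.noetherian N)
  choose! p hp using fun y (hy : y ∈ N) => hy
  have hsN (i) : s i ∈ N := hs ▸ Submodule.subset_span ⟨i, rfl⟩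
  refine ⟨r, fun i => p (s i), fun y => ?_⟩
  have hy : y.comp (Ext.mk₀ π) (add_zero 1) ∈ Submodule.span (End S) (Set.range s) :=
    hs ▸ ⟨y, rfl⟩
  obtain ⟨c, hc⟩ := (Submodule.mem_span_range_iff_exists_fun (End S)).1 hy
  refine ⟨fun i => Projective.factorThru (π ≫ End.asHom (c i)) π, ?_⟩
  rw [← sub_eq_zero]
  obtain ⟨z, hz⟩ := Ext.covariant_sequence_exact₂ P' (shortExact_kernel π)
    (y - ∑ i, (p (s i)).comp (Ext.mk₀ (Projective.factorThru (π ≫ End.asHom (c i)) π))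
      (add_zero 1)) (by
    change Ext.comp _ (Ext.mk₀ π) _ = 0
    rw [sub_eq_add_neg, Ext.add_comp, Ext.neg_comp, Ext.sum_comp, ← hc, ← sub_eq_add_neg,
      sub_eq_zero]
    refine Finset.sum_congr rfl fun i _ => ?_
    conv_lhs => rw [end_smul_ext, ← hp _ (hsN i)]
    rw [Ext.comp_assoc_of_third_deg_zero, Ext.mk₀_comp_mk₀, Ext.comp_assoc_of_third_deg_zero,
      Ext.mk₀_comp_mk₀, Projective.factorThru_comp])
  rw [← hz, hP' _ (hom_kernel_eq_zero hΔ.2 hπ0) 0 z, Ext.zero_comp]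

/-- The universal extension of `P'` by copies of a projective object `Δ` is projective. -/
theorem exists_projective_universal_extension [HasExt.{max u v} B] (hB : IsLengthCategory B)
    (hext : ExtFinite B) {Δ P' : B} [Projective Δ]
    (hΔ : Nontrivial (End Δ) ∧ ∀ x : End Δ, x ≠ 0 → IsUnit x)
    (hP' : ∀ X : B, (∀ f : Δ ⟶ X, f = 0) → ∀ (p : ℕ) (x : Ext.{max u v} P' X (p + 1)), x = 0) :
    ∃ (r : ℕ) (P : B) (f : (⨁ fun _ : Fin r => Δ) ⟶ P) (g : P ⟶ P') (w : f ≫ g = 0),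
      (ShortComplex.mk f g w).ShortExact ∧ Projective P := by
  obtain ⟨r, x, hx⟩ := exists_generators_ext_one hB hext hΔ hP'
  -- The universal class, whose components are the generators `x i`; hence all classes in Ext¹(P',
  -- Δ) are killed by pullback to the extension `P`.
  let ξ : Ext.{max u v} P' (⨁ fun _ : Fin r => Δ) 1 :=
    ∑ i, (x i).comp (Ext.mk₀ (biproduct.ι (fun _ : Fin r => Δ) i)) (add_zero 1)
  have hξ (i : Fin r) : ξ.comp (Ext.mk₀ (biproduct.π (fun _ : Fin r => Δ) i)) (add_zero 1) =
      x i := by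
    rw [Ext.sum_comp, Finset.sum_eq_single i]
    · rw [Ext.comp_assoc_of_third_deg_zero, Ext.mk₀_comp_mk₀, biproduct.ι_π_self,
        Ext.comp_mk₀_id]
    · intro j _ hj
      rw [Ext.comp_assoc_of_third_deg_zero, Ext.mk₀_comp_mk₀, biproduct.ι_π_ne _ hj,
        Ext.mk₀_zero, Ext.comp_zero]
    · simp
  obtain ⟨P, f, g, w, hS, hξS⟩ := exists_extClass_eq ξ
  have hproj : Projective (⨁ fun _ : Fin r => Δ) :=
    projective_biproduct _ fun _ => inferInstance
  refine ⟨r, P, f, g, w, hS, projective_of_ext_one_eq_zero P fun Y z => ?_⟩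
  have hlift (Y : B) (z : Ext.{max u v} P Y 1) : ∃ z' : Ext.{max u v} P' Y 1,
      (Ext.mk₀ g).comp z' (zero_add 1) = z :=
    Ext.contravariant_sequence_exact₂ hS Y z
      (Ext.eq_zero_of_projective (P := ⨁ fun _ : Fin r => Δ) _)
  -- Since Δ is projective, every class on `P` comes from `P'`. Induction on a composition series of
  -- `Y` reduces the vanishing to simple `T.X₃`.
  induction hB Y with
  | zero Y h0 =>
    rw [← Ext.comp_mk₀_id z, h0.eq_of_src (𝟙 Y) 0, Ext.mk₀_zero, Ext.comp_zero]
  | step T hT _ h₃ ih =>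
    have hz : z.comp (Ext.mk₀ T.g) (add_zero 1) = 0 := by
      obtain ⟨z', hz'⟩ := hlift _ (z.comp (Ext.mk₀ T.g) (add_zero 1))
      rw [← hz']
      by_cases h : ∀ q : Δ ⟶ T.X₃, q = 0
      · rw [hP' _ h 0 z', Ext.comp_zero]
      · push Not at h
        obtain ⟨q, hq⟩ := h
        have : Epi q := epi_of_nonzero_to_simple hq
        -- The obstruction to lifting `z'` to a class in Ext¹(P', Δ) lies in Ext²(P', ker q), which
        -- vanishes; this is why `hP'` is needed beyond degree one.
        obtain ⟨y, rfl⟩ := Ext.covariant_sequence_exact₃ P' (shortExact_kernel q) z' (n₁ := 2) rfl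
          (hP' _ (hom_kernel_eq_zero hΔ.2 hq) 1 _)
        obtain ⟨c, rfl⟩ := hx y
        have key : (Ext.mk₀ g).comp (∑ i, (x i).comp (Ext.mk₀ (c i)) (add_zero 1)) (zero_add 1) =
            0 := by
          rw [Ext.comp_sum]
          refine Finset.sum_eq_zero fun i _ => ?_
          rw [← hξ i, ← hξS, Ext.comp_assoc_of_third_deg_zero, Ext.mk₀_comp_mk₀,
            hS.comp_extClass_assoc]
        have h2 := Ext.comp_assoc_of_third_deg_zero (Ext.mk₀ g)
          (∑ i, (x i).comp (Ext.mk₀ (c i)) (add_zero 1)) (Ext.mk₀ q) (zero_add 1)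
        rw [key, Ext.zero_comp] at h2
        exact h2.symm
    obtain ⟨z₁, rfl⟩ := Ext.covariant_sequence_exact₂ P hT z hz
    rw [ih z₁, Ext.zero_comp]

end UniversalExtension

end

end HighestWeight

namespace HighestWeight

noncomputable section

attribute [local instance] CategoryTheory.Abelian.hasFiniteBiproducts

/-! ### Detecting generators and Serre subcategories on simple objects. -/

section Generators

variable {A : Type u} [Category.{v} A] [Abelian A]

/-- The split short exact sequence separating the first summand of a finite direct sum. -/
theorem exists_shortExact_biproduct_succ {r : ℕ} (X : Fin (r + 1) → A) :
    ∃ (f : X 0 ⟶ ⨁ X) (g : (⨁ X) ⟶ ⨁ fun j : Fin r => X j.succ) (w : f ≫ g = 0),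
      (ShortComplex.mk f g w).ShortExact := by
  let S := ShortComplex.mk (biproduct.ι X 0)
    (biproduct.lift fun j : Fin r => biproduct.π X j.succ) (by
      ext j
      simp [biproduct.ι_π_ne X (Fin.succ_ne_zero j).symm])
  have s : S.Splitting :=
    { r := biproduct.π X 0
      s := biproduct.desc fun j => biproduct.ι X j.succ
      f_r := biproduct.ι_π_self X 0
      s_g := by
        ext j k
        by_cases h : j = k
        · subst h
          simp [S]
        · have h' : j.succ ≠ k.succ := fun e => h (Fin.succ_injective _ e)
          simp [S, biproduct.ι_π_ne _ (Ne.symm h), biproduct.ι_π_ne X (Ne.symm h')]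
      id := by
        have h := biproduct.total (f := X)
        rw [Fin.sum_univ_succ] at h
        rw [biproduct.lift_desc]
        exact h }
  exact ⟨_, _, _, s.shortExact⟩

theorem isZero_biproduct_fin_zero (X : Fin 0 → A) : IsZero (⨁ X) := by
  rw [IsZero.iff_id_eq_zero]
  ext j
  exact j.elim0

theorem filt_biproduct {Q : ObjectProperty A} {r : ℕ} (X : Fin r → A) (h : ∀ j, Q (X j)) :
    Filt Q (⨁ X) := by
  induction r with
  | zero => exact .zero _ (isZero_biproduct_fin_zero X)
  | succ r ih =>
    obtain ⟨f, g, w, hS⟩ := exists_shortExact_biproduct_succ X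
    exact Filt.extension hS (Filt.of_prop (h 0)) (ih _ fun j => h j.succ)

/-- A projective object which maps nontrivially to every simple object of a length category is a
projective generator. -/
theorem isProjectiveGenerator_of_simple (hA : IsLengthCategory A) {P : A} (hP : Projective P)
    (h : ∀ T : A, Simple T → ∃ f : P ⟶ T, f ≠ 0) : IsProjectiveGenerator P := by
  refine ⟨hP, fun X => ?_⟩
  induction hA X with
  | zero X h0 => exact ⟨1, Nat.one_pos, 0, ⟨fun _ _ _ => h0.eq_of_src _ _⟩⟩
  | step S hS _ h₃ ih =>
    obtain ⟨r, -, p, hp⟩ := ih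
    obtain ⟨q, hq⟩ := h _ h₃
    have := hS.epi_g
    have : Epi q := epi_of_nonzero_to_simple hq
    let q' : P ⟶ S.X₂ := Projective.factorThru q S.g
    have hq' : q' ≫ S.g = q := Projective.factorThru_comp _ _
    let t : (j : Fin (r + 1)) → (P ⟶ S.X₂) :=
      Fin.cons q' fun j => biproduct.ι (fun _ : Fin r => P) j ≫ p ≫ S.f
    refine ⟨r + 1, r.succ_pos, biproduct.desc t,
      Preadditive.epi_of_cancel_zero _ fun {Z} z hz => ?_⟩
    have h0 : q' ≫ z = 0 := by
      have := congr(biproduct.ι _ 0 ≫ $hz)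
      simpa [t] using this
    have h1 : S.f ≫ z = 0 := by
      rw [← cancel_epi p]
      ext j
      have := congr(biproduct.ι _ j.succ ≫ $hz)
      simpa [t] using this
    obtain ⟨z', hz'⟩ := CokernelCofork.IsColimit.desc' hS.gIsCokernel z h1
    change S.g ≫ z' = z at hz'
    rw [← hz', ← Category.assoc, hq', ← comp_zero (f := q), cancel_epi] at h0
    rw [← hz', h0, comp_zero]

/-- A Serre subcategory is generated by objects which map nontrivially to all its simple
objects. -/
theorem prop_iff_serreObj (hA : IsLengthCategory A) {n : ℕ} {s : Set (Fin n)} {Δ : Fin n → A}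
    (P : ObjectProperty A) [P.IsSerreClass] (hs : ∀ j ∈ s, P (Δ j))
    (h : ∀ T : A, Simple T → P T → ∃ j ∈ s, ∃ f : Δ j ⟶ T, f ≠ 0) (X : A) :
    P X ↔ SerreObj s Δ X := by
  refine ⟨fun hX Q hQ hΔ => ?_, fun hX => hX P inferInstance hs⟩
  induction hA X with
  | zero X h0 => exact Q.prop_of_isZero h0
  | step S hS _ h₃ ih =>
    have hX' := (P.prop_iff_of_shortExact hS).1 hX
    obtain ⟨j, hj, f, hf⟩ := h _ h₃ hX'.2
    have : Epi f := epi_of_nonzero_to_simple hf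
    exact Q.prop_X₂_of_shortExact hS (ih hX'.1) (Q.prop_of_epi f (hΔ j hj))

end Generators

/-! ### Modules over a division ring and the regular right module. -/

section Modules

variable (Γ : Type v) [DivisionRing Γ]

theorem isZero_fgModuleCat_iff {R : Type v} [Ring R] [IsNoetherianRing R] (M : FGModuleCat.{v} R) :
    IsZero M ↔ ∀ m : M, m = 0 := by
  rw [IsZero.iff_id_eq_zero]
  constructor
  · intro h m
    exact congr(($h).hom.hom m)
  · intro h
    ext m
    exact h m

theorem surjective_of_epi_fgModuleCat {R : Type v} [Ring R] [IsNoetherianRing R]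
    {M N : FGModuleCat.{v} R} (f : M ⟶ N) [Epi f] : Function.Surjective f.hom.hom := by
  have : Epi ((forget₂ (FGModuleCat R) (ModuleCat.{v} R)).map f) := inferInstance
  exact (ModuleCat.epi_iff_surjective _).1 this

/-- The right module `Γ`. -/
abbrev regularModule : FGModuleCat.{v} Γᵐᵒᵖ :=
  haveI := finite_right_self Γ
  FGModuleCat.of Γᵐᵒᵖ Γ

/-- The map from the right module `Γ` to `M` given by an element of `M`. -/
def regularModuleHom {M : FGModuleCat.{v} Γᵐᵒᵖ} (m : M) : regularModule Γ ⟶ M :=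
  haveI := finite_right_self Γ
  ⟨ModuleCat.ofHom (X := Γ) (Y := M)
    { toFun := fun γ => MulOpposite.op γ • m
      map_add' := fun a b => by rw [MulOpposite.op_add, add_smul]
      map_smul' := fun a b => by
        change MulOpposite.op (b * a.unop) • m = a • MulOpposite.op b • m
        rw [MulOpposite.op_mul, mul_smul, MulOpposite.op_unop] }⟩

theorem regularModuleHom_apply {M : FGModuleCat.{v} Γᵐᵒᵖ} (m : M) (γ : Γ) :
    (regularModuleHom Γ m).hom.hom γ = MulOpposite.op γ • m := rfl

variable {Γ} in
theorem regularModule_hom_ext {M : FGModuleCat.{v} Γᵐᵒᵖ} {f g : regularModule Γ ⟶ M}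
    (h : f.hom.hom (1 : Γ) = g.hom.hom (1 : Γ)) : f = g := by
  ext
  exact h

instance projective_regularModule : Projective (regularModule Γ) where
  factors {E X} f e _ := by
    obtain ⟨m, hm⟩ := surjective_of_epi_fgModuleCat e (f.hom.hom (1 : Γ))
    refine ⟨regularModuleHom Γ m, regularModule_hom_ext ?_⟩
    change e.hom.hom (MulOpposite.op (1 : Γ) • m) = _
    rw [MulOpposite.op_one, one_smul, hm]

theorem hom_regularModule_eq_zero_iff (M : FGModuleCat.{v} Γᵐᵒᵖ) :
    (∀ f : regularModule Γ ⟶ M, f = 0) ↔ IsZero M := by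
  refine ⟨fun h => (isZero_fgModuleCat_iff M).2 fun m => ?_, fun h f => h.eq_of_tgt _ _⟩
  have := congr(($(h (regularModuleHom Γ m))).hom.hom (1 : Γ))
  rw [regularModuleHom_apply, MulOpposite.op_one, one_smul] at this
  exact this

theorem isIso_of_ne_zero_regularModule (f : regularModule Γ ⟶ regularModule Γ) (hf : f ≠ 0) :
    IsIso f := by
  let a : Γ := f.hom.hom (1 : Γ)
  have ha : a ≠ 0 := fun h => hf (regularModule_hom_ext h)
  have hfa : f = regularModuleHom Γ (M := regularModule Γ) a := regularModule_hom_ext (by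
    rw [regularModuleHom_apply, MulOpposite.op_one, one_smul])
  refine ⟨regularModuleHom Γ (M := regularModule Γ) (a⁻¹ : Γ), regularModule_hom_ext ?_,
    regularModule_hom_ext ?_⟩
  · rw [hfa]
    change (a⁻¹ * (a * 1) : Γ) = 1
    rw [mul_one, inv_mul_cancel₀ ha]
  · rw [hfa]
    change (a * (a⁻¹ * 1) : Γ) = 1
    rw [mul_one, mul_inv_cancel₀ ha]

theorem regularModule_id_ne_zero : 𝟙 (regularModule Γ) ≠ 0 := fun h =>
  one_ne_zero (α := Γ) congr(($h).hom.hom (1 : Γ))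

end Modules

/-! ### From a chain of recollements to standard objects. -/

namespace RecollementChain

variable {A : Type u} [Category.{v} A] [Abelian A] {n : ℕ} (C : RecollementChain A n)

/-- The standard object `Δ_i` as an object of the subcategory `A_i`. -/
def std (i : Fin n) : (C.sub i.succ).FullSubcategory :=
  (C.recollement i).jLeft.obj (regularModule (C.Γ i))

theorem sub_castSucc_iff_isZero {i : Fin n} {X : A} (hX : C.sub i.succ X) :
    C.sub i.castSucc X ↔ IsZero ((C.recollement i).j.obj ⟨X, hX⟩) := by
  rw [(C.recollement i).loc.isZero_iff]
  constructor
  · intro h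
    exact ⟨⟨X, h⟩, ⟨Iso.refl _⟩⟩
  · rintro ⟨Y, ⟨e⟩⟩
    have := C.closedUnderIso i.castSucc
    exact (C.sub i.castSucc).prop_of_iso ((C.sub i.succ).ι.mapIso e) Y.property

/-- Inside the larger subcategory the smaller one is the kernel of the exact functor `j`; being
Serre passes to the ambient category by transitivity. -/
theorem isSerreClass_castSucc (i : Fin n) (h : (C.sub i.succ).IsSerreClass) :
    (C.sub i.castSucc).IsSerreClass := by
  have := (C.recollement i).loc.exact_j.additive
  have := (C.recollement i).loc.exact_j.preservesFiniteLimits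
  have := (C.recollement i).loc.exact_j.preservesFiniteColimits
  have hle := C.le_succ i
  exact
    { exists_zero := by
        obtain ⟨Z, hZ, h'⟩ := (C.sub i.succ).exists_prop_of_containsZero
        refine ⟨Z, hZ, (C.sub_castSucc_iff_isZero h').2 ?_⟩
        exact (C.recollement i).j.map_isZero (isZero_of_isZero_map (C.sub i.succ).ι hZ)
      prop_of_mono := fun {X Y} f _ hY => by
        have hX : C.sub i.succ X := (C.sub i.succ).prop_of_mono f (hle _ hY)
        let f' : (⟨X, hX⟩ : (C.sub i.succ).FullSubcategory) ⟶ ⟨Y, hle _ hY⟩ :=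
          (C.sub i.succ).homMk f
        have : Mono f' := (C.sub i.succ).ι.mono_of_mono_map (inferInstanceAs (Mono f))
        rw [C.sub_castSucc_iff_isZero hX]
        exact IsZero.of_mono ((C.recollement i).j.map f')
          ((C.sub_castSucc_iff_isZero (hle _ hY)).1 hY)
      prop_of_epi := fun {X Y} f _ hX => by
        have hY : C.sub i.succ Y := (C.sub i.succ).prop_of_epi f (hle _ hX)
        let f' : (⟨X, hle _ hX⟩ : (C.sub i.succ).FullSubcategory) ⟶ ⟨Y, hY⟩ :=
          (C.sub i.succ).homMk f
        have : Epi f' := (C.sub i.succ).ι.epi_of_epi_map (inferInstanceAs (Epi f))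
        rw [C.sub_castSucc_iff_isZero hY]
        exact IsZero.of_epi ((C.recollement i).j.map f')
          ((C.sub_castSucc_iff_isZero (hle _ hX)).1 hX)
      prop_X₂_of_shortExact := fun {S} hS h₁ h₃ => by
        have h₂ : C.sub i.succ S.X₂ :=
          (C.sub i.succ).prop_X₂_of_shortExact hS (hle _ h₁) (hle _ h₃)
        have hS' := (shortExact_homMk (X₁ := ⟨S.X₁, hle _ h₁⟩) (X₂ := ⟨S.X₂, h₂⟩)
          (X₃ := ⟨S.X₃, hle _ h₃⟩) (w := S.zero) hS).map_of_exact (C.recollement i).j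
        rw [C.sub_castSucc_iff_isZero h₂]
        exact hS'.exact.isZero_of_both_isZero
          ((C.sub_castSucc_iff_isZero (hle _ h₁)).1 h₁)
          ((C.sub_castSucc_iff_isZero (hle _ h₃)).1 h₃) }

instance isSerreClass_sub (k : Fin (n + 1)) : (C.sub k).IsSerreClass := by
  induction k using Fin.reverseInduction with
  | last =>
    have : C.sub (Fin.last n) = ⊤ := by
      ext X
      simpa using C.sub_last X
    rw [this]
    infer_instance
  | cast i h => exact C.isSerreClass_castSucc i h

/-- By adjunction Hom(j_! Γ, X) ≅ Hom(Γ, jX), and the regular module detects zero objects. -/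
theorem hom_std_eq_zero_iff (i : Fin n) (X : (C.sub i.succ).FullSubcategory) :
    (∀ f : C.std i ⟶ X, f = 0) ↔ IsZero ((C.recollement i).j.obj X) := by
  have := (C.recollement i).loc.exact_j.additive
  have adj := (C.recollement i).coloc.adj_j
  rw [← hom_regularModule_eq_zero_iff (C.Γ i)]
  constructor
  · intro h f
    rw [← (adj.homEquiv _ _).right_inv f]
    have h0 : (adj.homEquiv _ _).symm f = 0 := h _
    change adj.homEquiv _ _ ((adj.homEquiv _ _).symm f) = 0
    rw [h0, Adjunction.homEquiv_unit, Functor.map_zero, comp_zero]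
  · intro h f
    apply (adj.homEquiv _ _).injective
    exact (h _).trans (h _).symm

theorem sub_castSucc_iff (i : Fin n) (X : A) :
    C.sub i.castSucc X ↔ C.sub i.succ X ∧ ∀ f : C.standardObject i ⟶ X, f = 0 := by
  constructor
  · intro h
    have hX := C.le_succ i _ h
    refine ⟨hX, fun f => ?_⟩
    exact congr(($((C.hom_std_eq_zero_iff i ⟨X, hX⟩).2 ((C.sub_castSucc_iff_isZero hX).1 h)
      ((C.sub i.succ).homMk f))).hom)
  · rintro ⟨hX, h⟩
    rw [C.sub_castSucc_iff_isZero hX, ← C.hom_std_eq_zero_iff]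
    exact fun f => (C.sub i.succ).hom_ext (h f.hom)

instance projective_std (i : Fin n) : Projective (C.std i) := by
  have := (C.recollement i).loc.exact_j.preservesFiniteColimits
  exact (C.recollement i).coloc.adj_j.map_projective _ (projective_regularModule (C.Γ i))

theorem std_end (i : Fin n) :
    Nontrivial (End (C.std i)) ∧ ∀ x : End (C.std i), x ≠ 0 → IsUnit x := by
  have := (C.recollement i).coloc.full_t
  have := (C.recollement i).coloc.faithful_t
  have := (C.recollement i).loc.exact_j.additive
  have := (C.recollement i).coloc.adj_j.left_adjoint_additive
  refine ⟨⟨𝟙 _, 0, fun h => ?_⟩, fun x hx => ?_⟩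
  · refine regularModule_id_ne_zero (C.Γ i) ((C.recollement i).jLeft.map_injective ?_)
    rw [CategoryTheory.Functor.map_id, Functor.map_zero]
    exact h
  · rw [isUnit_iff_isIso]
    obtain ⟨y, rfl⟩ := (C.recollement i).jLeft.map_surjective x
    have : IsIso y := isIso_of_ne_zero_regularModule _ y fun h => hx (by
      rw [h, Functor.map_zero]
      rfl)
    exact inferInstanceAs (IsIso ((C.recollement i).jLeft.map y))

theorem standardObject_end (i : Fin n) : Nontrivial (End (C.standardObject i)) ∧
    ∀ x : End (C.standardObject i), x ≠ 0 → IsUnit x := by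
  obtain ⟨⟨a, b, hab⟩, h⟩ := C.std_end i
  refine ⟨⟨a.hom, b.hom, fun h => hab ((C.sub i.succ).hom_ext h)⟩, fun x hx => ?_⟩
  rw [isUnit_iff_isIso]
  let x' : C.std i ⟶ C.std i := (C.sub i.succ).homMk x
  have : IsIso x' := (isUnit_iff_isIso x').1 (h x' fun h0 => hx congr(($h0).hom))
  exact inferInstanceAs (IsIso ((C.sub i.succ).ι.map x'))

theorem sub_mono : Monotone C.sub := by
  rw [Fin.monotone_iff_le_succ]
  exact C.le_succ

theorem sub_standardObject (i : Fin n) {k : Fin (n + 1)} (h : i.castSucc < k) :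
    C.sub k (C.standardObject i) :=
  C.sub_mono (Fin.castSucc_lt_iff_succ_le.1 h) _ (C.std i).property

theorem standardObject_hom_eq_zero (i j : Fin n) (h : j < i)
    (f : C.standardObject i ⟶ C.standardObject j) : f = 0 :=
  ((C.sub_castSucc_iff i _).1 (C.sub_standardObject j (Fin.castSucc_lt_castSucc_iff.2 h))).2 f

/-- If `X` receives no map from the top standard object it drops one step in the chain; a nonzero
object cannot drop down to the zero subcategory. -/
theorem exists_standardObject_hom_ne_zero {k : Fin (n + 1)} {X : A} (hX : C.sub k X)
    (h0 : ¬ IsZero X) : ∃ j : Fin n, j.castSucc < k ∧ ∃ f : C.standardObject j ⟶ X, f ≠ 0 := by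
  induction k using Fin.induction with
  | zero => exact (h0 ((C.sub_zero X).1 hX)).elim
  | succ i ih =>
    by_cases h : ∀ f : C.standardObject i ⟶ X, f = 0
    · obtain ⟨j, hj, f, hf⟩ := ih ((C.sub_castSucc_iff i X).2 ⟨hX, h⟩)
      exact ⟨j, hj.trans Fin.castSucc_lt_succ, f, hf⟩
    · push Not at h
      exact ⟨i, Fin.castSucc_lt_succ, h⟩

theorem sub_succ_iff_serreObj (hA : IsLengthCategory A) (i : Fin n) (X : A) :
    C.sub i.succ X ↔ SerreObj (Set.Iic i) C.standardObject X := by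
  refine prop_iff_serreObj hA (C.sub i.succ) (fun j hj => C.sub_standardObject j ?_)
    (fun T hT hT' => ?_) X
  · exact Fin.castSucc_lt_succ_iff.2 hj
  · obtain ⟨j, hj, h⟩ := C.exists_standardObject_hom_ne_zero hT' (Simple.not_isZero T)
    exact ⟨j, Fin.castSucc_lt_succ_iff.1 hj, h⟩

/-- Such an `X` lies in the smaller subcategory, where `P` is projective, and the homological
embedding identifies the Ext groups. This supplies the hypothesis `hP'` for universal extensions. -/
theorem ext_eq_zero_of_projective (i : Fin n) (P : (C.sub i.castSucc).FullSubcategory)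
    [Projective P] (X : (C.sub i.succ).FullSubcategory) (hX : ∀ f : C.std i ⟶ X, f = 0)
    [HasExt.{max u v} (C.sub i.succ).FullSubcategory] (p : ℕ)
    (x : Ext.{max u v} ((ObjectProperty.ιOfLE (C.le_succ i)).obj P) X (p + 1)) : x = 0 := by
  have hX' : C.sub i.castSucc X.obj :=
    (C.sub_castSucc_iff_isZero X.property).2 ((C.hom_std_eq_zero_iff i X).1 hX)
  have _ : HasExt.{max u v} (C.sub i.castSucc).FullSubcategory := HasExt.standard _
  obtain ⟨y, rfl⟩ := (C.isHomological i P ⟨X.obj, hX'⟩ (p + 1)).2 x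
  rw [Ext.eq_zero_of_projective y, map_zero]

/-- The projective is built by climbing the chain, starting with Δ_i itself and taking a universal
extension by copies of Δ_l at each later step. -/
theorem exists_projective (hA : IsLengthCategory A) (hext : ExtFinite A) (i : Fin n)
    (k : Fin (n + 1)) (hk : i.castSucc < k) :
    ∃ (P : (C.sub k).FullSubcategory) (_ : Projective P) (U : A) (f : U ⟶ P.obj)
      (g : P.obj ⟶ C.standardObject i) (w : f ≫ g = 0),
      (ShortComplex.mk f g w).ShortExact ∧ FiltObj (Set.Ioi i) C.standardObject U := by
  induction k using Fin.induction with
  | zero => exact absurd hk (Fin.not_lt_zero _)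
  | succ l ih =>
    rcases (Fin.castSucc_lt_succ_iff.1 hk).eq_or_lt with rfl | hlt
    · refine ⟨C.std i, inferInstance, _, kernel.ι (𝟙 _), 𝟙 _, kernel.condition _,
        shortExact_kernel (𝟙 (C.standardObject i)), .zero _ ?_⟩
      exact (isZero_zero A).of_iso (kernel.ofMono (𝟙 (C.standardObject i)))
    · obtain ⟨P', hP', U, f, g, w, hS, hU⟩ := ih (Fin.castSucc_lt_castSucc_iff.2 hlt)
      have _ : HasExt.{max u v} (C.sub l.succ).FullSubcategory := HasExt.standard _
      obtain ⟨r, P, f', g', w', hS', hP⟩ := exists_projective_universal_extension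
        (isLengthCategory_fullSubcategory (C.sub l.succ) hA)
        (extFinite_fullSubcategory (C.sub l.succ) hext) (C.std_end l)
        (P' := (ObjectProperty.ιOfLE (C.le_succ l)).obj P')
        (fun X hX p x => C.ext_eq_zero_of_projective l P' X hX p x)
      have hS'' := shortExact_hom hS'
      let a : P.obj ⟶ P'.obj := g'.hom
      have : Epi a := hS''.epi_g
      have := hS.epi_g
      refine ⟨P, hP, _, kernel.ι (a ≫ g), a ≫ g, kernel.condition _,
        shortExact_kernel (a ≫ g), ?_⟩
      -- The new kernel is an extension of the old `U` by copies of Δ_l, with `i < l`.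
      obtain ⟨R, hR, e₁, e₂, e₃⟩ := exists_shortExact_kernel_comp a g
      refine Filt.of_iso (eqToIso e₂) (Filt.extension hR ?_ ?_)
      · refine Filt.of_iso (IsLimit.conePointUniqueUpToIso hS''.fIsKernel (kernelIsKernel a) ≪≫
          eqToIso e₁.symm) ?_
        refine Filt.map (C.sub l.succ).ι (isExactFunctor_ι _) (Q := fun Y => Y = C.std l) ?_
          (filt_biproduct _ fun _ => rfl)
        rintro _ rfl
        exact ⟨l, hlt, ⟨Iso.refl _⟩⟩
      · exact Filt.of_iso (IsLimit.conePointUniqueUpToIso hS.fIsKernel (kernelIsKernel g) ≪≫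
          eqToIso e₃.symm) hU

theorem projective_obj_last (P : (C.sub (Fin.last n)).FullSubcategory) [Projective P] :
    Projective P.obj where
  factors {E X} f e he := by
    let e' : (⟨E, C.sub_last E⟩ : (C.sub (Fin.last n)).FullSubcategory) ⟶ ⟨X, C.sub_last X⟩ :=
      (C.sub (Fin.last n)).homMk e
    have : Epi e' := (C.sub (Fin.last n)).ι.epi_of_epi_map he
    let f' : P ⟶ ⟨X, C.sub_last X⟩ := (C.sub (Fin.last n)).homMk f
    exact ⟨(Projective.factorThru f' e').hom, congr(($(Projective.factorThru_comp f' e')).hom)⟩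

theorem isStandardSequence (hA : IsLengthCategory A) (hext : ExtFinite A) :
    IsStandardSequence C.standardObject := by
  choose P hP U f g w hS hU using fun i => C.exists_projective hA hext i (Fin.last n)
    (Fin.castSucc_lt_last i)
  refine ⟨U, fun i => (P i).obj, f, g, w, hS, C.standardObject_end,
    fun i j h f => C.standardObject_hom_eq_zero i j h f, hU, ?_⟩
  refine isProjectiveGenerator_of_simple hA
    (projective_biproduct _ fun i => C.projective_obj_last (P i)) fun T hT => ?_
  obtain ⟨j, -, q, hq⟩ := C.exists_standardObject_hom_ne_zero (C.sub_last T) (Simple.not_isZero T)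
  have := (hS j).epi_g
  refine ⟨biproduct.π _ j ≫ g j ≫ q, fun h => hq ?_⟩
  rwa [← Category.assoc, ← comp_zero (f := biproduct.π (fun i => (P i).obj) j ≫ g j),
    cancel_epi] at h

end RecollementChain

end

end HighestWeight

namespace HighestWeight

noncomputable section

attribute [local instance] CategoryTheory.Abelian.hasFiniteBiproducts

section LengthOfBiproducts

open ZeroObject

variable {A : Type u} [Category.{v} A] [Abelian A]

theorem hasLength_one {T : A} (hT : Simple T) : HasLength T 1 :=
  .step (ShortComplex.mk (0 : (0 : A) ⟶ T) (𝟙 T) (by simp))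
    { exact := (ShortComplex.exact_iff_mono _ (by simp)).2 inferInstance
      mono_f := ⟨fun _ _ _ => (isZero_zero A).eq_of_tgt _ _⟩ }
    (.zero _ (isZero_zero A)) hT

theorem hasLength_biproduct {X : A} {n : ℕ} (h : HasLength X n) (r : ℕ) :
    HasLength (⨁ fun _ : Fin r => X) (r * n) := by
  induction r with
  | zero =>
    rw [zero_mul]
    exact .zero _ (isZero_biproduct_fin_zero _)
  | succ r ih =>
    obtain ⟨f, g, w, hS⟩ := exists_shortExact_biproduct_succ fun _ : Fin (r + 1) => X
    have h := HasLength.extension hS h ih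
    rwa [show n + r * n = (r + 1) * n by ring] at h

end LengthOfBiproducts

/-! ### Bounding lengths by dimensions of Hom and Ext¹. -/

section ExtDimensions

attribute [local instance] extModuleEnd

variable {A : Type u} [Category.{v} A] [Abelian A] [HasExt.{max u v} A]

theorem finrank_le_add_of_range_eq_ker {D V₁ V₂ V₃ : Type*} [DivisionRing D] [AddCommGroup V₁]
    [Module D V₁] [AddCommGroup V₂] [Module D V₂] [AddCommGroup V₃] [Module D V₃]
    [Module.Finite D V₁] [Module.Finite D V₂] [Module.Finite D V₃]
    (f : V₁ →ₗ[D] V₂) (g : V₂ →ₗ[D] V₃) (h : LinearMap.range f = LinearMap.ker g) :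
    Module.finrank D V₂ ≤ Module.finrank D V₁ + Module.finrank D V₃ := by
  rw [← LinearMap.finrank_range_add_finrank_ker g, ← h, add_comm]
  exact Nat.add_le_add (LinearMap.finrank_range_le f) (Submodule.finrank_le _)

theorem finite_ext_zero {X S : A} (hX : Filt (fun S => Simple S) X) (hS : Simple S) :
    Module.Finite (End S) (Ext.{max u v} X S 0) := by
  refine finite_ext_of_filt hS 0 (fun X hX => ?_) hX
  by_cases h : ∃ e : X ⟶ S, e ≠ 0
  · obtain ⟨e, he⟩ := h
    have := isIso_of_hom_simple he
    refine ⟨⟨{Ext.mk₀ e}, ?_⟩⟩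
    rw [eq_top_iff]
    intro x _
    obtain ⟨f, rfl⟩ := (Ext.mk₀_bijective _ _).2 x
    rw [Finset.coe_singleton, Submodule.mem_span_singleton]
    refine ⟨End.of (inv e ≫ f), ?_⟩
    rw [end_smul_ext, Ext.mk₀_comp_mk₀]
    simp
  · push Not at h
    have : Subsingleton (Ext.{max u v} X S 0) := subsingleton_of_forall_eq 0 fun x => by
      obtain ⟨f, rfl⟩ := (Ext.mk₀_bijective _ _).2 x
      rw [h f, Ext.mk₀_zero]
    infer_instance

theorem range_extPrecomp_eq_ker_extClass {S : ShortComplex A} (hS : S.ShortExact) (Y : A) :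
    LinearMap.range (extPrecomp Y (Ext.mk₀ S.f) (zero_add 0)) =
      LinearMap.ker (extPrecomp Y hS.extClass (add_zero 1)) := by
  ext x
  constructor
  · rintro ⟨y, rfl⟩
    exact hS.extClass_comp_assoc y (h := add_zero 1)
  · intro hx
    exact Ext.contravariant_sequence_exact₁ hS Y x (add_zero 1) hx

/-- Each composition factor of `K` contributes at most the dimension of one of finitely many groups
Ext¹ between the `S i`; summing all of these gives a crude uniform constant. -/
theorem exists_finrank_ext_one_le (hA : IsLengthCategory A) (hext : ExtFinite A) {m : ℕ}
    (S : Fin m → A) (hS : ∀ T : A, Simple T → ∃ i, Nonempty (T ≅ S i)) :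
    ∃ c : ℕ, ∀ j, Simple (S j) → ∀ (K : A) (n : ℕ), HasLength K n →
      Module.finrank (End (S j)) (Ext.{max u v} K (S j) 1) ≤ n * c := by
  refine ⟨∑ i, ∑ j, Module.finrank (End (S j)) (Ext.{max u v} (S i) (S j) 1),
    fun j hj K n hK => ?_⟩
  have hfin (X : A) : Module.Finite (End (S j)) (Ext.{max u v} X (S j) 1) :=
    finite_ext_of_filt hj 1 (fun X hX => hext X (S j) hX hj) (hA X)
  induction hK with
  | zero X h0 =>
    have := subsingleton_ext_of_isZero h0 (S j) 1
    rw [Module.finrank_zero_of_subsingleton]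
    exact Nat.zero_le _
  | step T hT h₁ h₃ ih =>
    have h := finrank_le_add_of_range_eq_ker _ _ (range_extPrecomp_eq_ker hT (S j) 1)
    obtain ⟨i, ⟨e⟩⟩ := hS _ h₃
    have hinj : Function.Injective
        (extPrecomp (S j) (Ext.mk₀ e.inv) (zero_add 1) :
          Ext.{max u v} T.X₃ (S j) 1 →ₗ[End (S j)] _) := by
      intro x y hxy
      have h' := congr((Ext.mk₀ e.hom).comp $hxy (zero_add 1))
      change (Ext.mk₀ e.hom).comp ((Ext.mk₀ e.inv).comp x (zero_add 1)) (zero_add 1) =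
        (Ext.mk₀ e.hom).comp ((Ext.mk₀ e.inv).comp y (zero_add 1)) (zero_add 1) at h'
      rwa [Ext.mk₀_comp_mk₀_assoc, Ext.mk₀_comp_mk₀_assoc, e.hom_inv_id, Ext.mk₀_id_comp,
        Ext.mk₀_id_comp] at h'
    have h1 := LinearMap.finrank_le_finrank_of_injective hinj
    have h2 : Module.finrank (End (S j)) (Ext.{max u v} (S i) (S j) 1) ≤
        ∑ i, ∑ j, Module.finrank (End (S j)) (Ext.{max u v} (S i) (S j) 1) :=
      (Finset.single_le_sum (f := fun j =>
        Module.finrank (End (S j)) (Ext.{max u v} (S i) (S j) 1))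
        (fun _ _ => Nat.zero_le _) (Finset.mem_univ j)).trans
      (Finset.single_le_sum (f := fun i =>
        ∑ j, Module.finrank (End (S j)) (Ext.{max u v} (S i) (S j) 1))
        (fun _ _ => Nat.zero_le _) (Finset.mem_univ i))
    rw [Nat.succ_mul]
    omega

/-- Subobjects of powers of a fixed object of finite length have bounded length if their tops
have bounded length. -/
theorem exists_length_bound (hA : IsLengthCategory A) (hext : ExtFinite A) {m : ℕ}
    (S : Fin m → A) (hS : ∀ T : A, Simple T → ∃ i, Nonempty (T ≅ S i)) (I : A) (d : ℕ) :
    ∃ N : ℕ, ∀ (Y : A) (r : ℕ) (i : Y ⟶ ⨁ fun _ : Fin r => I), Mono i →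
      (∀ j, Simple (S j) → Module.finrank (End (S j)) (Ext.{max u v} Y (S j) 0) ≤ d) →
      ∃ k ≤ N, HasLength Y k := by
  obtain ⟨c, hc⟩ := exists_finrank_ext_one_le hA hext S hS
  induction hA I generalizing d with
  | zero I h0 =>
    refine ⟨0, fun Y r i _ _ => ⟨0, le_rfl, .zero _ (IsZero.of_mono i ?_)⟩⟩
    rw [IsZero.iff_id_eq_zero]
    ext
    exact h0.eq_of_tgt _ _
  | step T hT _ h₃ ih =>
    have := hT.mono_f
    obtain ⟨j, ⟨e⟩⟩ := hS _ h₃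
    have hj : Simple (S j) := Simple.of_iso e.symm
    -- The kernel of `β` below has Hom to each simple of dimension at most `d`, from `Y`, plus `d *
    -- c`, from Ext¹ of the image of `β`, whose length is at most `d`.
    obtain ⟨N, hN⟩ := ih (d + d * c)
    refine ⟨N + d, fun Y r i _ hY => ?_⟩
    have := finite_ext_zero (hA Y) hj
    let b := Module.finBasis (End (S j)) (Ext.{max u v} Y (S j) 0)
    -- Assembled from a basis of Hom(Y, S j), so every map `Y ⟶ S j` vanishes on its kernel.
    let β : Y ⟶ ⨁ fun _ : Fin (Module.finrank (End (S j)) (Ext.{max u v} Y (S j) 0)) => S j :=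
      biproduct.lift fun k => Ext.homEquiv₀ (b k)
    have hβ (f : Y ⟶ S j) : kernel.ι β ≫ f = 0 := by
      apply (Ext.mk₀_bijective _ _).1
      rw [Ext.mk₀_zero, ← Ext.mk₀_comp_mk₀, ← b.sum_repr (Ext.mk₀ f), Ext.comp_sum]
      refine Finset.sum_eq_zero fun k _ => ?_
      rw [end_smul_ext, ← Ext.comp_assoc_of_third_deg_zero, ← Ext.mk₀_homEquiv₀_apply (b k),
        Ext.mk₀_comp_mk₀]
      have : kernel.ι β ≫ Ext.homEquiv₀ (b k) = 0 := by
        rw [← show β ≫ biproduct.π _ k = Ext.homEquiv₀ (b k) from biproduct.lift_π _ _,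
          kernel.condition_assoc, zero_comp]
      rw [this, Ext.mk₀_zero, Ext.zero_comp]
    obtain ⟨l, hl, hlen, -⟩ := (hasLength_biproduct (hasLength_one hj) _).of_mono
      (Abelian.image.ι β)
    have hl' : l ≤ d := hl.trans ((mul_one _).le.trans (hY j hj))
    have hker : (ShortComplex.mk (kernel.ι β) (Abelian.factorThruImage β) (by
        rw [← cancel_mono (Abelian.image.ι β)]; simp)).ShortExact :=
      { exact := by
          have h := ShortComplex.exact_kernel β
          exact (ShortComplex.exact_iff_of_epi_of_isIso_of_mono
            ({ τ₁ := 𝟙 _, τ₂ := 𝟙 _, τ₃ := Abelian.image.ι β } :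
              ShortComplex.mk (kernel.ι β) (Abelian.factorThruImage β) (by
                rw [← cancel_mono (Abelian.image.ι β)]; simp) ⟶
              ShortComplex.mk (kernel.ι β) β (kernel.condition β))).2 h }
    -- Each component of `kernel β → T.X₂ ^ r` dies in the simple quotient `T.X₃ ≅ S j`, so `kernel
    -- β` embeds in a power of the shorter object `T.X₁`.
    have hlift (k : Fin r) : ∃ t : kernel β ⟶ T.X₁,
        t ≫ T.f = kernel.ι β ≫ i ≫ biproduct.π _ k := by
      have h0 : (kernel.ι β ≫ i ≫ biproduct.π _ k) ≫ T.g = 0 := by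
        rw [← cancel_mono e.hom, zero_comp]
        simpa using hβ (i ≫ biproduct.π _ k ≫ T.g ≫ e.hom)
      obtain ⟨t, ht⟩ := KernelFork.IsLimit.lift' hT.fIsKernel _ h0
      exact ⟨t, ht⟩
    choose t ht using hlift
    have hmono : Mono (biproduct.lift t) := by
      have h0 : biproduct.lift t ≫ biproduct.map (fun _ : Fin r => T.f) = kernel.ι β ≫ i := by
        ext k
        simp [ht]
      have : Mono (kernel.ι β ≫ i) := inferInstance
      rw [← h0] at this
      exact mono_of_mono _ (biproduct.map fun _ : Fin r => T.f)
    obtain ⟨k, hk, hkl⟩ := hN _ _ _ hmono fun j' hj' => by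
      have := finite_ext_zero (hA Y) hj'
      have := finite_ext_zero (hA (kernel β)) hj'
      have : Module.Finite (End (S j')) (Ext.{max u v} (Abelian.image β) (S j') 1) :=
        finite_ext_of_filt hj' 1 (fun X hX => hext X (S j') hX hj') (hA _)
      have h1 := finrank_le_add_of_range_eq_ker _ _ (range_extPrecomp_eq_ker_extClass hker (S j'))
      have h2 := hc j' hj' _ _ hlen
      have h3 := Nat.mul_le_mul_right c hl'
      have h4 := hY j' hj'
      exact h1.trans (Nat.add_le_add h4 (h2.trans h3))
    exact ⟨k + l, Nat.add_le_add hk hl', hkl.extension hker hlen⟩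

end ExtDimensions

/-! ### The dual length bound. -/

section Opposite

variable {A : Type u} [Category.{v} A] [Abelian A]

theorem HasLength.op {X : A} {n : ℕ} (h : HasLength X n) : HasLength (Opposite.op X) n := by
  induction h with
  | zero X h0 => exact .zero _ h0.op
  | step S hS _ h₃ ih =>
    rw [add_comm]
    exact HasLength.extension hS.op (hasLength_one (simple_op h₃)) ih

theorem HasLength.unop {X : Aᵒᵖ} {n : ℕ} (h : HasLength X n) : HasLength X.unop n := by
  induction h with
  | zero X h0 => exact .zero _ h0.unop
  | step S hS _ h₃ ih =>
    rw [add_comm]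
    exact HasLength.extension hS.unop (hasLength_one (simple_unop h₃)) ih

theorem isLengthCategory_op (hA : IsLengthCategory A) : IsLengthCategory Aᵒᵖ := fun X =>
  (hasLength_len hA X.unop).op.filt

attribute [local instance] extModuleEnd in
/-- In a length category with a generator whose opposite category is Ext-finite, the length of an
object `Z` is bounded if it is the cokernel of a map `K ⟶ Y` where the length of `K` is bounded
and every simple object which maps nontrivially to `Z` does not map nontrivially to `Y`. -/
theorem exists_length_bound_of_generator (hA : IsLengthCategory A)
    (hsimple : HasFinitelyManySimples A) (hext : ExtFinite Aᵒᵖ) {G : A}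
    (hG : ∀ X : A, ∃ (r : ℕ) (p : (⨁ fun _ : Fin r => G) ⟶ X), Epi p) (d : ℕ) :
    ∃ N : ℕ, ∀ (S : ShortComplex A), S.ShortExact → len S.X₁ ≤ d →
      (∀ T : A, Simple T → (∀ f : T ⟶ S.X₂, f = 0) ∨ (∀ f : T ⟶ S.X₃, f = 0)) →
      len S.X₃ ≤ N := by
  have _ : HasExt.{max u v} Aᵒᵖ := HasExt.standard _
  obtain ⟨m, s, hs⟩ := hsimple
  have hs' (T : Aᵒᵖ) (hT : Simple T) : ∃ i, Nonempty (T ≅ Opposite.op (s i)) := by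
    obtain ⟨i, ⟨e⟩⟩ := hs T.unop (simple_unop hT)
    exact ⟨i, ⟨e.symm.op⟩⟩
  have hA' := isLengthCategory_op hA
  obtain ⟨c, hc⟩ := exists_finrank_ext_one_le hA' hext (fun i => Opposite.op (s i)) hs'
  obtain ⟨N, hN⟩ := exists_length_bound hA' hext (fun i => Opposite.op (s i)) hs'
    -- If Hom(T, S.X₂) = 0 for a simple T, then Hom(T, S.X₃) embeds in Ext¹(T, S.X₁), of dimension
    -- at most `d * c`; otherwise Hom(T, S.X₃) = 0. Thus the socle of `S.X₃` is under control, which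
    -- is the dual of a bounded top.
    (Opposite.op G) (d * c)
  refine ⟨N, fun S hS hd hT => ?_⟩
  obtain ⟨r, p, hp⟩ := hG S.X₃
  let i : Opposite.op S.X₃ ⟶ ⨁ fun _ : Fin r => Opposite.op G :=
    biproduct.lift fun k => (biproduct.ι (fun _ : Fin r => G) k ≫ p).op
  have hi : Mono i := Preadditive.mono_of_cancel_zero _ fun {Z} z hz => by
    apply Quiver.Hom.unop_inj
    rw [← cancel_epi p]
    ext k
    have := congr(($hz ≫ biproduct.π _ k).unop)
    simpa [i] using this
  obtain ⟨k, hk, hkl⟩ := hN _ r i hi fun j hj => by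
    have hjs : Simple (s j) := simple_unop hj
    have key (Y : A) (h : ∀ f : s j ⟶ Y, f = 0) :
        Subsingleton (Ext.{max u v} (Opposite.op Y) (Opposite.op (s j)) 0) :=
      subsingleton_of_forall_eq 0 fun x => by
        obtain ⟨f, rfl⟩ := (Ext.mk₀_bijective _ _).2 x
        rw [show f = 0 from Quiver.Hom.unop_inj (h f.unop), Ext.mk₀_zero]
    rcases hT _ hjs with h | h
    · have : Subsingleton (Ext.{max u v} S.op.X₂ (Opposite.op (s j)) 0) := key _ h
      have := finite_ext_zero (hA' S.op.X₂) hj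
      have := finite_ext_zero (hA' S.op.X₁) hj
      have : Module.Finite (End (Opposite.op (s j)))
          (Ext.{max u v} S.op.X₃ (Opposite.op (s j)) 1) :=
        finite_ext_of_filt hj 1 (fun X hX => hext X _ hX hj) (hA' _)
      have h1 := finrank_le_add_of_range_eq_ker _ _
        (range_extPrecomp_eq_ker_extClass hS.op (Opposite.op (s j)))
      have h2 : Module.finrank (End (Opposite.op (s j)))
        (Ext.{max u v} S.op.X₂ (Opposite.op (s j)) 0) = 0 :=
        Module.finrank_zero_of_subsingleton
      have h3 := hc j hj _ _ (hasLength_len hA S.X₁).op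
      have h4 := Nat.mul_le_mul_right c hd
      exact h1.trans (by rw [h2, zero_add]; exact h3.trans h4)
    · have := key _ h
      rw [Module.finrank_zero_of_subsingleton]
      exact Nat.zero_le _
  exact hkl.unop.len_le.trans hk

end Opposite

end

end HighestWeight

namespace HighestWeight

noncomputable section

attribute [local instance] CategoryTheory.Abelian.hasFiniteBiproducts

/-! ### Right adjoints of exact functors through reduced maps. -/

section CouniversalArrows

open ZeroObject

variable {B : Type u} [Category.{v} B] [Abelian B] {E : Type u₂} [Category.{v₂} E] [Abelian E]

/-- A map `ξ : j Y ⟶ M` is reduced if no nonzero map to `Y` is killed by it. -/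
def IsReduced (j : B ⥤ E) {Y : B} {M : E} (ξ : j.obj Y ⟶ M) : Prop :=
  ∀ (K : B) (k : K ⟶ Y), j.map k ≫ ξ = 0 → k = 0

/-- Divide `Y` by its largest subobject killed by `ξ`. A map to the quotient that is still killed
pulls back to a killed map to `Y`, hence is zero. -/
theorem exists_isReduced (hB : IsLengthCategory B) (j : B ⥤ E) (hj : IsExactFunctor j) {Y : B}
    {M : E} (ξ : j.obj Y ⟶ M) :
    ∃ (Z : B) (p : Y ⟶ Z) (ζ : j.obj Z ⟶ M), j.map p ≫ ζ = ξ ∧ IsReduced j ζ := by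
  have := hj.additive
  have := hj.preservesFiniteLimits
  have := hj.preservesFiniteColimits
  obtain ⟨K, k, _, hk, hK⟩ := exists_largest_mono hB Y (fun K k => j.map k ≫ ξ = 0)
    (by rw [Functor.map_zero, zero_comp])
    (fun K L f g hf hg => by
      rw [biprod.desc_eq, Functor.map_add, Preadditive.add_comp, j.map_comp, j.map_comp,
        Category.assoc, Category.assoc, hf, hg, comp_zero, comp_zero, add_zero])
    (fun K L e f _ h => by
      rwa [j.map_comp, Category.assoc, ← comp_zero (f := j.map e), cancel_epi] at h)
  have hS := (shortExact_cokernel k).map_of_exact j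
  obtain ⟨ζ, hζ⟩ : ∃ ζ : j.obj (cokernel k) ⟶ M, j.map (cokernel.π k) ≫ ζ = ξ :=
    ⟨_, (CokernelCofork.IsColimit.desc' hS.gIsCokernel ξ hk).2⟩
  refine ⟨cokernel k, cokernel.π k, ζ, hζ, fun L l hl => ?_⟩
  obtain ⟨g, hg⟩ := hK _ (pullback.fst (cokernel.π k) l) (by
    rw [← hζ, ← Category.assoc, ← j.map_comp, pullback.condition, j.map_comp, Category.assoc, hl,
      comp_zero])
  rw [← cancel_epi (pullback.snd (cokernel.π k) l), ← pullback.condition, ← hg, Category.assoc,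
    cokernel.condition, comp_zero, comp_zero]

/-- A reduced pair of maximal length is couniversal: uniqueness of factorizations is reducedness,
and existence follows because a further pair cannot enlarge it. -/
theorem isLeftAdjoint_of_isReduced_bounded (hB : IsLengthCategory B) (j : B ⥤ E)
    (hj : IsExactFunctor j)
    (h : ∀ M : E, ∃ N : ℕ, ∀ (Y : B) (ξ : j.obj Y ⟶ M), IsReduced j ξ → len Y ≤ N) :
    j.IsLeftAdjoint := by
  have := hj.additive
  refine isLeftAdjoint_of_exists_universal j fun M => ?_
  obtain ⟨N, hN⟩ := h M
  let D : Set ℕ := {n | ∃ (Y : B) (ξ : j.obj Y ⟶ M), IsReduced j ξ ∧ len Y = n}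
  have hD : D.Nonempty := ⟨_, 0, 0, fun K k _ => (isZero_zero B).eq_of_tgt _ _, rfl⟩
  have hb : BddAbove D := ⟨N, by
    rintro n ⟨Y, ξ, hξ, rfl⟩
    exact hN Y ξ hξ⟩
  obtain ⟨Y, ξ, hξ, hlen⟩ := Nat.sSup_mem hD hb
  refine ⟨Y, ξ, fun Z ζ => existsUnique_of_exists_of_unique ?_ fun a b ha hb => ?_⟩
  · obtain ⟨W, p, ω, hp, hω⟩ := exists_isReduced hB j hj
      (j.map (biprod.fst : Z ⊞ Y ⟶ Z) ≫ ζ + j.map (biprod.snd : Z ⊞ Y ⟶ Y) ≫ ξ)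
    have ha : j.map (biprod.inl ≫ p) ≫ ω = ζ := by
      rw [j.map_comp, Category.assoc, hp, Preadditive.comp_add, ← Category.assoc,
        ← Category.assoc, ← j.map_comp, ← j.map_comp, biprod.inl_fst, biprod.inl_snd,
        CategoryTheory.Functor.map_id, Category.id_comp, Functor.map_zero, zero_comp, add_zero]
    have hb' : j.map (biprod.inr ≫ p) ≫ ω = ξ := by
      rw [j.map_comp, Category.assoc, hp, Preadditive.comp_add, ← Category.assoc,
        ← Category.assoc, ← j.map_comp, ← j.map_comp, biprod.inr_fst, biprod.inr_snd,
        CategoryTheory.Functor.map_id, Category.id_comp, Functor.map_zero, zero_comp, zero_add]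
    have : Mono (biprod.inr ≫ p) := Preadditive.mono_of_cancel_zero _ fun {K} k hk => hξ K k (by
      rw [← hb', ← Category.assoc, ← j.map_comp, hk, Functor.map_zero, zero_comp])
    have : IsIso (biprod.inr ≫ p) := isIso_of_mono_of_len_le hB _ (by
      rw [hlen]
      exact le_csSup hb ⟨_, _, hω, rfl⟩)
    refine ⟨(biprod.inl ≫ p) ≫ inv (biprod.inr ≫ p), ?_⟩
    rw [← hb', ← Category.assoc, ← j.map_comp, Category.assoc _ (inv _), IsIso.inv_hom_id,
      Category.comp_id, ha]
  · rw [← sub_eq_zero]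
    refine hξ _ _ ?_
    rw [Functor.map_sub, Preadditive.sub_comp, ha, hb, sub_self]

end CouniversalArrows

/-! ### Universal arrows and full faithfulness of a left adjoint. -/

section UniversalArrows

variable {C : Type u₁} [Category.{v₁} C] {D : Type u₂} [Category.{v₂} D]

theorem exists_iso_of_universal {F : C ⥤ D} {G : D ⥤ C} (adj : F ⊣ G) {X : C} {L : D}
    (η : X ⟶ G.obj L) (hη : ∀ (Y : D) (f : X ⟶ G.obj Y), ∃! g : L ⟶ Y, η ≫ G.map g = f) :
    ∃ e : L ≅ F.obj X, η ≫ G.map e.hom = adj.unit.app X := by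
  obtain ⟨a, ha, -⟩ := hη _ (adj.unit.app X)
  let b : F.obj X ⟶ L := (adj.homEquiv _ _).symm η
  have hb : adj.unit.app X ≫ G.map b = η :=
    (adj.homEquiv_unit _ _ b).symm.trans ((adj.homEquiv _ _).apply_symm_apply η)
  refine ⟨⟨a, b, (hη _ η).unique ?_ (by simp), ?_⟩, ha⟩
  · rw [G.map_comp, ← Category.assoc, ha, hb]
  · apply (adj.homEquiv _ _).injective
    rw [adj.homEquiv_unit, adj.homEquiv_unit, G.map_comp, ← Category.assoc, hb, ha]
    simp

theorem fullyFaithful_of_universal {F : C ⥤ D} {G : D ⥤ C} (adj : F ⊣ G)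
    (h : ∀ X : C, ∃ (L : D) (η : X ⟶ G.obj L), IsIso η ∧
      ∀ (Y : D) (f : X ⟶ G.obj Y), ∃! g : L ⟶ Y, η ≫ G.map g = f) : F.Full ∧ F.Faithful := by
  have (X : C) : IsIso (adj.unit.app X) := by
    obtain ⟨L, η, _, hη⟩ := h X
    obtain ⟨e, he⟩ := exists_iso_of_universal adj η hη
    rw [← he]
    infer_instance
  have : IsIso adj.unit := NatIso.isIso_of_isIso_app _
  exact ⟨adj.fullyFaithfulLOfIsIsoUnit.full, adj.fullyFaithfulLOfIsIsoUnit.faithful⟩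

end UniversalArrows

/-! ### The functor Hom(Δ, -) for a projective Δ with division endomorphism ring. -/

section HomFunctor

variable {B : Type u} [Category.{v} B] [Abelian B] {Δ : B}

/-- The division ring of endomorphisms of an object all of whose nonzero endomorphisms are
invertible. -/
abbrev divisionRingEnd (hΔ : Nontrivial (End Δ) ∧ ∀ x : End Δ, x ≠ 0 → IsUnit x) :
    DivisionRing (End Δ) :=
  haveI := hΔ.1
  .ofIsUnitOrEqZero fun x => or_iff_not_imp_right.2 (hΔ.2 x)

/-- Composition with a map is linear over the endomorphism ring of the source. -/
def homPostcomp (Δ : B) {X Y : B} (f : X ⟶ Y) : (Δ ⟶ X) →ₗ[(End Δ)ᵐᵒᵖ] (Δ ⟶ Y) where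
  toFun g := g ≫ f
  map_add' _ _ := Preadditive.add_comp _ _ _ _ _ _
  map_smul' _ _ := Category.assoc _ _ _

theorem range_homPostcomp_eq_ker {S : ShortComplex B} (hS : S.ShortExact) :
    LinearMap.range (homPostcomp Δ S.f) = LinearMap.ker (homPostcomp Δ S.g) := by
  have := hS.mono_f
  ext x
  constructor
  · rintro ⟨y, rfl⟩
    change (y ≫ S.f) ≫ S.g = 0
    rw [Category.assoc, S.zero, comp_zero]
  · intro hx
    obtain ⟨y, hy⟩ := KernelFork.IsLimit.lift' hS.fIsKernel x hx
    exact ⟨y, hy⟩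

/-- For simple X, any nonzero map Δ → X is epi, so by projectivity it generates Hom(Δ, X);
composition factors then add up. -/
theorem finite_hom (hB : IsLengthCategory B) [Projective Δ]
    (hΔ : Nontrivial (End Δ) ∧ ∀ x : End Δ, x ≠ 0 → IsUnit x) (X : B) :
    Module.Finite (End Δ)ᵐᵒᵖ (Δ ⟶ X) := by
  let _ := divisionRingEnd hΔ
  induction hB X with
  | zero X h0 =>
    have : Subsingleton (Δ ⟶ X) := ⟨fun _ _ => h0.eq_of_tgt _ _⟩
    infer_instance
  | step S hS _ h₃ ih =>
    have : Module.Finite (End Δ)ᵐᵒᵖ (Δ ⟶ S.X₃) := by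
      by_cases h : ∃ p : Δ ⟶ S.X₃, p ≠ 0
      · obtain ⟨p, hp⟩ := h
        have : Epi p := epi_of_nonzero_to_simple hp
        refine ⟨⟨{p}, ?_⟩⟩
        rw [eq_top_iff]
        intro f _
        rw [Finset.coe_singleton, Submodule.mem_span_singleton]
        exact ⟨MulOpposite.op (End.of (Projective.factorThru f p)),
          Projective.factorThru_comp f p⟩
      · push Not at h
        have : Subsingleton (Δ ⟶ S.X₃) := subsingleton_of_forall_eq 0 h
        infer_instance
    have : IsNoetherian (End Δ)ᵐᵒᵖ (Δ ⟶ S.X₂) :=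
      isNoetherian_of_range_eq_ker _ _ (range_homPostcomp_eq_ker hS)
    infer_instance

/-- The image of `t` is the trace of Δ in X. Recording the number of copies as a dimension makes it
comparable with the dimension of a target module. -/
theorem exists_hom_generators (hB : IsLengthCategory B) [Projective Δ]
    (hΔ : Nontrivial (End Δ) ∧ ∀ x : End Δ, x ≠ 0 → IsUnit x) (X : B) :
    ∃ t : (⨁ fun _ : Fin (Module.finrank (End Δ)ᵐᵒᵖ (Δ ⟶ X)) => Δ) ⟶ X,
      ∀ f : Δ ⟶ X, ∃ g, g ≫ t = f := by
  let _ := divisionRingEnd hΔ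
  have := finite_hom hB hΔ X
  let b := Module.finBasis (End Δ)ᵐᵒᵖ (Δ ⟶ X)
  refine ⟨biproduct.desc b, fun f => ⟨biproduct.lift fun k => End.asHom (b.repr f k).unop, ?_⟩⟩
  rw [biproduct.lift_desc]
  exact b.sum_repr f

theorem hom_eq_zero_of_epi [Projective Δ] {T X Y : B} {t : T ⟶ X}
    (ht : ∀ f : Δ ⟶ X, ∃ g, g ≫ t = f) (p : X ⟶ Y) [Epi p] (h : t ≫ p = 0) (f : Δ ⟶ Y) :
    f = 0 := by
  obtain ⟨g, hg⟩ := ht (Projective.factorThru f p)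
  rw [← Projective.factorThru_comp f p, ← hg, Category.assoc, h, comp_zero]

/-- The functor `Hom(Δ, -)` with values in finitely generated modules. -/
def homFunctor (hfin : ∀ X : B, Module.Finite (End Δ)ᵐᵒᵖ (Δ ⟶ X)) :
    B ⥤ FGModuleCat.{v} (End Δ)ᵐᵒᵖ :=
  (ModuleCat.isFG _).lift (preadditiveCoyonedaObj Δ) hfin

theorem isExactFunctor_homFunctor [Projective Δ] [IsNoetherianRing (End Δ)ᵐᵒᵖ]
    (hfin : ∀ X : B, Module.Finite (End Δ)ᵐᵒᵖ (Δ ⟶ X)) : IsExactFunctor (homFunctor hfin) where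
  additive := ⟨by intros; ext; exact Preadditive.comp_add _ _ _ _ _ _⟩
  preservesFiniteLimits := by
    have : PreservesFiniteLimits (homFunctor hfin ⋙ (ModuleCat.isFG.{v} (End Δ)ᵐᵒᵖ).ι) :=
      inferInstanceAs (PreservesFiniteLimits (preadditiveCoyonedaObj Δ))
    exact preservesFiniteLimits_of_reflects_of_preserves _ (ModuleCat.isFG.{v} (End Δ)ᵐᵒᵖ).ι
  preservesFiniteColimits := by
    have : PreservesFiniteColimits (homFunctor hfin ⋙ (ModuleCat.isFG.{v} (End Δ)ᵐᵒᵖ).ι) :=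
      inferInstanceAs (PreservesFiniteColimits (preadditiveCoyonedaObj Δ))
    exact preservesFiniteColimits_of_reflects_of_preserves _ (ModuleCat.isFG.{v} (End Δ)ᵐᵒᵖ).ι

end HomFunctor

end

end HighestWeight

namespace HighestWeight

noncomputable section

attribute [local instance] CategoryTheory.Abelian.hasFiniteBiproducts

section HomFunctor

variable {B : Type u} [Category.{v} B] [Abelian B] {Δ : B}

theorem isZero_homFunctor_obj_iff [IsNoetherianRing (End Δ)ᵐᵒᵖ]
    (hfin : ∀ X : B, Module.Finite (End Δ)ᵐᵒᵖ (Δ ⟶ X)) (X : B) :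
    IsZero ((homFunctor hfin).obj X) ↔ ∀ f : Δ ⟶ X, f = 0 :=
  isZero_fgModuleCat_iff _

/-- An element of Hom(Δ, Y) killed by ξ is a map m : Δ → Y with ξ(c ≫ m) = 0 for every endomorphism
c, so reducedness applies to m itself. -/
theorem injective_of_isReduced (hfin : ∀ X : B, Module.Finite (End Δ)ᵐᵒᵖ (Δ ⟶ X))
    [IsNoetherianRing (End Δ)ᵐᵒᵖ] {Y : B}
    {M : FGModuleCat.{v} (End Δ)ᵐᵒᵖ} {ξ : (homFunctor hfin).obj Y ⟶ M}
    (hξ : IsReduced (homFunctor hfin) ξ) : Function.Injective ξ.hom.hom := by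
  rw [injective_iff_map_eq_zero]
  intro (m : Δ ⟶ Y) hm
  refine hξ Δ m ?_
  refine FGModuleCat.hom_ext (LinearMap.ext fun (c : Δ ⟶ Δ) => ?_)
  change ξ.hom.hom (c ≫ m) = 0
  exact (ξ.hom.hom.map_smul (MulOpposite.op (End.of c)) m).trans (by rw [hm, smul_zero])

/-- The trace of Δ in Y is a quotient of at most dim M copies of Δ, hence bounded. The quotient Y /
trace is bounded by `exists_length_bound_of_generator`. -/
theorem len_bounded_of_isReduced (hB : IsLengthCategory B) (hsimple : HasFinitelyManySimples B)
    (hext : ExtFinite Bᵒᵖ) {G : B}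
    (hG : ∀ X : B, ∃ (r : ℕ) (p : (⨁ fun _ : Fin r => G) ⟶ X), Epi p) [Projective Δ]
    (hΔ : Nontrivial (End Δ) ∧ ∀ x : End Δ, x ≠ 0 → IsUnit x) [IsNoetherianRing (End Δ)ᵐᵒᵖ]
    (hfin : ∀ X : B, Module.Finite (End Δ)ᵐᵒᵖ (Δ ⟶ X)) (M : FGModuleCat.{v} (End Δ)ᵐᵒᵖ) :
    ∃ N : ℕ, ∀ (Y : B) (ξ : (homFunctor hfin).obj Y ⟶ M), IsReduced (homFunctor hfin) ξ →
      len Y ≤ N := by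
  let _ := divisionRingEnd hΔ
  have hj := isExactFunctor_homFunctor hfin
  have := hj.additive
  obtain ⟨N, hN⟩ := exists_length_bound_of_generator hB hsimple hext hG
    (Module.finrank (End Δ)ᵐᵒᵖ M * len Δ)
  refine ⟨Module.finrank (End Δ)ᵐᵒᵖ M * len Δ + N, fun Y ξ hξ => ?_⟩
  obtain ⟨t, ht⟩ := exists_hom_generators hB hΔ Y
  have hrank : Module.finrank (End Δ)ᵐᵒᵖ (Δ ⟶ Y) ≤ Module.finrank (End Δ)ᵐᵒᵖ M :=
    LinearMap.finrank_le_finrank_of_injective (f := ξ.hom.hom) (injective_of_isReduced hfin hξ)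
  have hS := shortExact_cokernel (Abelian.image.ι t)
  have h1 : len (Abelian.image t) ≤ Module.finrank (End Δ)ᵐᵒᵖ M * len Δ := by
    obtain ⟨k, hk, hkl⟩ := (hasLength_biproduct (hasLength_len hB Δ) _).of_epi
      (Abelian.factorThruImage t)
    exact hkl.len_le.trans (hk.trans (Nat.mul_le_mul_right _ hrank))
  have h2 : len (cokernel (Abelian.image.ι t)) ≤ N := by
    refine hN _ hS h1 fun T hT => ?_
    -- If Δ maps onto T, then T does not map to Y / trace, which receives no nonzero map from Δ.
    -- Otherwise Hom(Δ, T) = 0 and reducedness forbids nonzero maps T → Y.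
    by_cases h : ∃ g : Δ ⟶ T, g ≠ 0
    · obtain ⟨g, hg⟩ := h
      have : Epi g := epi_of_nonzero_to_simple hg
      refine .inr fun f => ?_
      rw [← cancel_epi g, comp_zero]
      refine hom_eq_zero_of_epi ht (cokernel.π (Abelian.image.ι t)) ?_ _
      have h0 := congr(Abelian.factorThruImage t ≫ $(cokernel.condition (Abelian.image.ι t)))
      rwa [← Category.assoc, Abelian.image.fac, comp_zero] at h0
    · push Not at h
      refine .inl fun f => hξ T f ?_
      rw [((isZero_homFunctor_obj_iff hfin T).2 h).eq_of_src ((homFunctor hfin).map f) 0,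
        zero_comp]
  exact ((hasLength_len hB _).extension hS (hasLength_len hB _)).len_le.trans
    (Nat.add_le_add h1 h2)

/-- A basis of M identifies it with End(Δ)^r = Hom(Δ, Δ^r), so the universal object is Δ^r and the
unit is invertible. -/
theorem exists_universal_homFunctor
    (hΔ : Nontrivial (End Δ) ∧ ∀ x : End Δ, x ≠ 0 → IsUnit x)
    (hfin : ∀ X : B, Module.Finite (End Δ)ᵐᵒᵖ (Δ ⟶ X)) (M : FGModuleCat.{v} (End Δ)ᵐᵒᵖ) :
    ∃ (L : B) (η : M ⟶ (homFunctor hfin).obj L), IsIso η ∧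
      ∀ (Y : B) (f : M ⟶ (homFunctor hfin).obj Y), ∃! g : L ⟶ Y,
        η ≫ (homFunctor hfin).map g = f := by
  let _ := divisionRingEnd hΔ
  let b := Module.finBasis (End Δ)ᵐᵒᵖ M
  let L : B := ⨁ fun _ : Fin (Module.finrank (End Δ)ᵐᵒᵖ M) => Δ
  let ι (k) : Δ ⟶ L := biproduct.ι (fun _ : Fin (Module.finrank (End Δ)ᵐᵒᵖ M) => Δ) k
  let η : M ⟶ (homFunctor hfin).obj L := ⟨ModuleCat.ofHom (Y := (Δ ⟶ L)) (b.constr ℕ ι)⟩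
  have hη (k) : η.hom.hom (b k) = ι k := b.constr_basis ℕ ι k
  refine ⟨L, η, ?_, fun Y f => ?_⟩
  · have hsum (m : M) : η.hom.hom m = ∑ k, End.asHom (b.repr m k).unop ≫ ι k :=
      b.constr_apply_fintype ℕ ι m
    have hinj : Function.Injective η.hom.hom := by
      rw [injective_iff_map_eq_zero]
      intro m hm
      replace hm := (hsum m).symm.trans hm
      change _ = (0 : Δ ⟶ L) at hm
      refine b.ext_elem fun k => ?_
      have h := congr($hm ≫ biproduct.π _ k)
      rw [Preadditive.sum_comp, Finset.sum_eq_single k, Category.assoc, biproduct.ι_π_self,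
        Category.comp_id, zero_comp] at h
      · rw [map_zero]
        exact MulOpposite.unop_injective h
      · intro l _ hl
        rw [Category.assoc, biproduct.ι_π_ne _ hl, comp_zero]
      · simp
    have hsurj : Function.Surjective η.hom.hom := fun (x : Δ ⟶ L) => by
      refine ⟨∑ k, MulOpposite.op (End.of (x ≫ biproduct.π _ k)) • b k, ?_⟩
      rw [map_sum]
      have h := congr(x ≫ $(biproduct.total (f := fun _ : Fin _ => Δ)))
      rw [Preadditive.comp_sum, Category.comp_id] at h
      refine .trans (Finset.sum_congr rfl fun k _ => ?_) h
      rw [map_smul, hη]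
      exact Category.assoc _ _ _
    exact inferInstanceAs (IsIso (LinearEquiv.ofBijective η.hom.hom
      ⟨hinj, hsurj⟩).toFGModuleCatIso.hom)
  · refine ⟨biproduct.desc fun k => f.hom.hom (b k), ?_, fun g hg => ?_⟩
    · ext : 1
      refine b.ext fun k => ?_
      change η.hom.hom (b k) ≫ biproduct.desc _ = _
      rw [hη]
      exact biproduct.ι_desc _ _
    · refine biproduct.hom_ext' _ _ fun k => ?_
      refine .trans ?_ (biproduct.ι_desc (fun k => (f.hom.hom (b k) : Δ ⟶ Y)) k).symm
      rw [← hg]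
      exact congr($(hη k) ≫ g).symm

end HomFunctor

/-! ### The recollement attached to such a projective object. -/

section Recollement

variable {B : Type u} [Category.{v} B] [Abelian B] {Δ : B} {B' : Type u₁} [Category.{v₁} B']
  (i : B' ⥤ B) [i.Full] [i.Faithful]

/-- The reflection of X is X modulo the trace of Δ; projectivity of Δ ensures that the quotient
receives no further maps from Δ. -/
theorem isRightAdjoint_of_essImage (hB : IsLengthCategory B) [Projective Δ]
    (hΔ : Nontrivial (End Δ) ∧ ∀ x : End Δ, x ≠ 0 → IsUnit x)
    (hi : ∀ X : B, i.essImage X ↔ ∀ f : Δ ⟶ X, f = 0) : i.IsRightAdjoint := by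
  refine isRightAdjoint_of_exists_universal i fun X => ?_
  obtain ⟨t, ht⟩ := exists_hom_generators hB hΔ X
  obtain ⟨L, ⟨e⟩⟩ := (hi (cokernel t)).2
    (hom_eq_zero_of_epi ht (cokernel.π t) (cokernel.condition t))
  refine ⟨L, cokernel.π t ≫ e.inv, fun Y f => ?_⟩
  have hf : t ≫ f = 0 := by
    ext k
    rw [comp_zero]
    exact (hi _).1 ⟨Y, ⟨Iso.refl _⟩⟩ _
  obtain ⟨g, hg⟩ := i.map_surjective (e.hom ≫ cokernel.desc t f hf)
  refine ⟨g, by simp [hg], fun g' hg' => i.map_injective ?_⟩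
  rw [hg, ← cancel_epi e.inv, ← cancel_epi (cokernel.π t), ← Category.assoc, hg']
  simp

/-- The coreflection of X is its largest subobject without nonzero maps from Δ; projectivity makes
this class closed under images. -/
theorem isLeftAdjoint_of_essImage (hB : IsLengthCategory B) [Projective Δ]
    (hi : ∀ X : B, i.essImage X ↔ ∀ f : Δ ⟶ X, f = 0) : i.IsLeftAdjoint := by
  refine isLeftAdjoint_of_exists_universal i fun X => ?_
  obtain ⟨K, k, _, hk, hK⟩ := exists_largest_mono hB X (fun K k => ∀ g : Δ ⟶ K, g ≫ k = 0)
    (fun g => comp_zero)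
    (fun K L f g hf hg h => by
      rw [biprod.desc_eq, Preadditive.comp_add, ← Category.assoc, ← Category.assoc, hf, hg,
        add_zero])
    (fun K L e f _ h g => by
      rw [← Projective.factorThru_comp g e, Category.assoc]
      exact h _)
  obtain ⟨L, ⟨e⟩⟩ := (hi K).2 fun f => by rw [← cancel_mono k, hk, zero_comp]
  refine ⟨L, e.hom ≫ k, fun Y f => ?_⟩
  obtain ⟨h, hh⟩ := hK _ f fun g => by
    rw [(hi _).1 ⟨Y, ⟨Iso.refl _⟩⟩ g, zero_comp]
  obtain ⟨g, hg⟩ := i.map_surjective (h ≫ e.inv)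
  refine ⟨g, by simp [hg, hh], fun g' hg' => i.map_injective ?_⟩
  rw [← cancel_mono (e.hom ≫ k), hg', hg]
  simp [hh]

/-- The recollement given by a projective object whose endomorphism ring is a division ring. -/
theorem exists_recollement [Abelian B'] (hB : IsLengthCategory B)
    (hsimple : HasFinitelyManySimples B)
    (hext : ExtFinite Bᵒᵖ) {G : B}
    (hG : ∀ X : B, ∃ (r : ℕ) (p : (⨁ fun _ : Fin r => G) ⟶ X), Epi p) [Projective Δ]
    (hΔ : Nontrivial (End Δ) ∧ ∀ x : End Δ, x ≠ 0 → IsUnit x) (hi : IsExactFunctor i)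
    (hi' : ∀ X : B, i.essImage X ↔ ∀ f : Δ ⟶ X, f = 0) :
    ∃ (Γ : Type v) (_ : DivisionRing Γ) (R : Recollement i (FGModuleCat.{v} Γᵐᵒᵖ)),
      Nonempty (R.jLeft.obj (regularModule Γ) ≅ Δ) := by
  let _ := divisionRingEnd hΔ
  have hfin := finite_hom hB hΔ
  let j := homFunctor hfin
  have hj : IsExactFunctor j := isExactFunctor_homFunctor hfin
  have : i.IsRightAdjoint := isRightAdjoint_of_essImage i hB hΔ hi'
  have : i.IsLeftAdjoint := isLeftAdjoint_of_essImage i hB hi'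
  have : j.IsRightAdjoint := isRightAdjoint_of_exists_universal j fun M => by
    obtain ⟨L, η, -, hη⟩ := exists_universal_homFunctor hΔ hfin M
    exact ⟨L, η, hη⟩
  have : j.IsLeftAdjoint := isLeftAdjoint_of_isReduced_bounded hB j hj
    (len_bounded_of_isReduced hB hsimple hext hG hΔ hfin)
  have hz (X : B) : IsZero (j.obj X) ↔ i.essImage X :=
    (isZero_homFunctor_obj_iff hfin X).trans (hi' X).symm
  let adj₁ := Adjunction.ofIsRightAdjoint j
  let adj₂ := Adjunction.ofIsLeftAdjoint j
  obtain ⟨h₁, h₂⟩ := fullyFaithful_of_universal adj₁ (exists_universal_homFunctor hΔ hfin)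
  -- In an adjoint triple the left adjoint is fully faithful exactly when the right one is.
  let ff := (Adjunction.Triple.mk adj₁ adj₂).fullyFaithfulEquiv (.ofFullyFaithful _)
  refine ⟨End Δ, inferInstance,
    { iLeft := i.leftAdjoint
      iRight := i.rightAdjoint
      j := j
      jLeft := j.leftAdjoint
      jRight := j.rightAdjoint
      loc := ⟨hi, hj, .ofIsLeftAdjoint i, adj₂, inferInstance, inferInstance, ff.full,
        ff.faithful, hz⟩
      coloc := ⟨hi, hj, .ofIsRightAdjoint i, adj₁, inferInstance, inferInstance, h₁, h₂, hz⟩ }, ?_⟩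
  obtain ⟨e, -⟩ := exists_iso_of_universal adj₁
    (regularModuleHom (End Δ) (M := j.obj Δ) (𝟙 Δ)) fun Y f => by
      refine ⟨f.hom.hom (1 : End Δ), regularModule_hom_ext ?_, fun g hg => ?_⟩
      · change ((1 : (End Δ)ᵐᵒᵖ) • 𝟙 Δ) ≫ _ = f.hom.hom (1 : End Δ)
        rw [one_smul]
        exact Category.id_comp _
      · rw [← hg]
        change _ = ((1 : (End Δ)ᵐᵒᵖ) • 𝟙 Δ) ≫ g
        rw [one_smul, Category.id_comp]
  exact ⟨e.symm⟩

end Recollement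

end

end HighestWeight

namespace HighestWeight

noncomputable section

attribute [local instance] CategoryTheory.Abelian.hasFiniteBiproducts

/-! ### Vanishing, projectivity and reordering of filtrations. -/

section Filtrations

variable {A : Type u} [Category.{v} A] [Abelian A]

theorem Filt.flatten {Q : ObjectProperty A} {X : A} (h : Filt (fun Y => Filt Q Y) X) :
    Filt Q X := by
  induction h with
  | zero X hX => exact .zero _ hX
  | step S hS _ h₃ ih => exact Filt.extension hS ih h₃

theorem hom_eq_zero_of_filt {Q : ObjectProperty A} {X Y : A} (h : Filt Q X)
    (hQ : ∀ Z, Q Z → ∀ f : Z ⟶ Y, f = 0) (f : X ⟶ Y) : f = 0 := by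
  induction h with
  | zero X hX => exact hX.eq_of_src _ _
  | step S hS _ h₃ ih =>
    have := hS.epi_g
    obtain ⟨t, ht⟩ := CokernelCofork.IsColimit.desc' hS.gIsCokernel f (ih _)
    change S.g ≫ t = f at ht
    rw [← ht, hQ _ h₃ t, comp_zero]

theorem ext_eq_zero_of_filt [HasExt.{max u v} A] {Q : ObjectProperty A} {X Y : A} (h : Filt Q X)
    {n : ℕ} (hQ : ∀ Z, Q Z → ∀ x : Ext.{max u v} Z Y n, x = 0) (x : Ext.{max u v} X Y n) :
    x = 0 := by
  induction h with
  | zero X hX => exact (subsingleton_ext_of_isZero hX Y n).elim _ _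
  | step S hS _ h₃ ih =>
    obtain ⟨y, rfl⟩ := Ext.contravariant_sequence_exact₂ hS Y x (ih _)
    rw [hQ _ h₃ y, Ext.comp_zero]

theorem projective_of_shortExact {S : ShortComplex A} (hS : S.ShortExact)
    (h₁ : Projective S.X₁) (h₃ : Projective S.X₃) : Projective S.X₂ where
  factors {E X} f e _ := by
    have := hS.epi_g
    have := hS.mono_f
    let s := ShortComplex.Splitting.ofExactOfSection S hS.exact (Projective.factorThru (𝟙 _) S.g)
      (Projective.factorThru_comp _ _) hS.mono_f
    refine ⟨s.r ≫ Projective.factorThru (S.f ≫ f) e + S.g ≫ Projective.factorThru (s.s ≫ f) e, ?_⟩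
    rw [Preadditive.add_comp, Category.assoc, Category.assoc, Projective.factorThru_comp,
      Projective.factorThru_comp, ← Category.assoc, ← Category.assoc, ← Preadditive.add_comp,
      s.id, Category.id_comp]

theorem projective_of_filt {Q : ObjectProperty A} (hQ : ∀ X, Q X → Projective X) {X : A}
    (h : Filt Q X) : Projective X := by
  induction h with
  | zero X hX =>
    exact ⟨fun {E Y} f e _ => ⟨0, hX.eq_of_src _ _⟩⟩
  | step S hS _ h₃ ih => exact projective_of_shortExact hS ih (hQ _ h₃)

theorem exists_shortExact_corefinement {S T : ShortComplex A} (hS : S.ShortExact)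
    (hT : T.ShortExact) (e : S.X₁ ≅ T.X₂) :
    ∃ (W : A) (f : T.X₃ ⟶ W) (g : W ⟶ S.X₃) (w : f ≫ g = 0) (f' : T.X₁ ⟶ S.X₂) (g' : S.X₂ ⟶ W)
      (w' : f' ≫ g' = 0), (ShortComplex.mk f g w).ShortExact ∧
        (ShortComplex.mk f' g' w').ShortExact := by
  obtain ⟨W, f, g, w, f', g', w', h, h'⟩ := exists_shortExact_refinement hS.op hT.op e.op
  exact ⟨_, g.unop, f.unop, _, g'.unop, f'.unop, _, h.unop, h'.unop⟩

/-- An object filtered by `Q` and an object `Δ` which is projective relative to these objects has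
a subobject filtered by copies of `Δ` such that the quotient is filtered by `Q`. -/
theorem exists_shortExact_of_filt {Q : ObjectProperty A} {Δ : A} (P : ObjectProperty A)
    [P.IsSerreClass] (hP : ∀ X, Q X → P X) (hPΔ : P Δ)
    (hΔ : ∀ (X : A) (p : X ⟶ Δ), P X → Epi p → ∃ s : Δ ⟶ X, s ≫ p = 𝟙 Δ) {X : A}
    (h : Filt (fun Y => Q Y ∨ Nonempty (Y ≅ Δ)) X) :
    ∃ S : ShortComplex A, S.ShortExact ∧ Filt (fun Y => Nonempty (Y ≅ Δ)) S.X₁ ∧ S.X₂ = X ∧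
      Filt Q S.X₃ := by
  induction h with
  | zero X hX =>
    exact ⟨_, shortExact_kernel (𝟙 X), .zero _ (IsZero.of_mono (kernel.ι (𝟙 X)) hX), rfl,
      .zero _ hX⟩
  | step S hS h₁ h₃ ih =>
    obtain ⟨T, hT, hT₁, hT₂, hT₃⟩ := ih
    rcases h₃ with h₃ | ⟨⟨e⟩⟩
    · obtain ⟨W, f, g, w, f', g', w', h, h'⟩ :=
        exists_shortExact_corefinement hS hT (eqToIso hT₂.symm)
      exact ⟨_, h', hT₁, rfl, .step _ h hT₃ h₃⟩
    · have hP₂ : P S.X₂ := by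
        refine Filt.prop (Q := fun Y => Q Y ∨ Nonempty (Y ≅ Δ)) ?_ (.step S hS h₁ (.inr ⟨e⟩))
        rintro Y (hY | ⟨⟨e⟩⟩)
        · exact hP Y hY
        · exact P.prop_of_iso e.symm hPΔ
      have := hS.epi_g
      have := hS.mono_f
      have := hT.epi_g
      -- A factor Δ on top splits off. Projecting to the complement `S.X₁` and then to `T.X₃` has as
      -- kernel an extension of `T.X₁` by a copy of Δ, so Δ has moved to the bottom.
      obtain ⟨s, hs⟩ := hΔ S.X₂ (S.g ≫ e.hom) hP₂ inferInstance
      let σ := ShortComplex.Splitting.ofExactOfSection S hS.exact (e.hom ≫ s) (by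
        rw [← cancel_mono e.hom, Category.assoc, Category.assoc, hs, Category.comp_id,
          Category.id_comp]) hS.mono_f
      have : Epi σ.r := epi_of_epi_fac σ.f_r
      let a : S.X₂ ⟶ T.X₂ := σ.r ≫ (eqToIso hT₂.symm).hom
      have : Epi a := epi_comp _ _
      obtain ⟨R, hR, e₁, e₂, e₃⟩ := exists_shortExact_kernel_comp a T.g
      have hσ : (ShortComplex.mk σ.s σ.r σ.s_r).ShortExact :=
        ShortComplex.Splitting.shortExact
          { r := S.g
            s := S.f
            f_r := σ.s_g
            s_g := σ.f_r
            id := by rw [add_comm]; exact σ.id }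
      refine ⟨_, shortExact_kernel (a ≫ T.g), ?_, rfl, hT₃⟩
      refine Filt.of_iso (eqToIso e₂) (Filt.extension hR (.of_prop ?_) ?_)
      · exact ⟨eqToIso e₁ ≪≫ kernelCompMono _ _ ≪≫
          IsLimit.conePointUniqueUpToIso (limit.isLimit _) hσ.fIsKernel ≪≫ e⟩
      · exact hT₁.of_iso (IsLimit.conePointUniqueUpToIso hT.fIsKernel (kernelIsKernel T.g) ≪≫
          eqToIso e₃.symm)

end Filtrations

/-! ### A criterion for homological embeddings. -/

section Homological

variable {A' : Type u₁} [Category.{v₁} A'] [Abelian A'] {A : Type u₂} [Category.{v₂} A]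
  [Abelian A]

attribute [local instance] Ext.subsingleton_of_projective in
attribute [local simp] Ext.mapExactFunctor_comp Ext.mapExactFunctor_mk₀
  Ext.mapExactFunctor_extClass in
/-- A fully faithful exact functor is a homological embedding if all objects are quotients of
projective objects which are sent to acyclic ones. -/
theorem isHomologicalEmbedding_of_acyclic [HasExt.{max u₂ v₂} A] (i : A' ⥤ A) [i.Full]
    [i.Faithful] (hi : IsExactFunctor i)
    (h : ∀ X : A', ∃ (Q : A') (p : Q ⟶ X), Epi p ∧ Projective Q ∧ ∀ (Y : A') (n : ℕ)
      (x : Ext.{max u₂ v₂} (i.obj Q) (i.obj Y) (n + 1)), x = 0) :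
    IsHomologicalEmbedding i hi := by
  have := hi.additive
  have := hi.preservesFiniteLimits
  have := hi.preservesFiniteColimits
  let _ : HasExt.{max u₁ v₁} A' := HasExt.standard A'
  intro X Y n
  induction n generalizing X with
  | zero => simpa [Ext.mapExactFunctor₀] using ⟨i.map_injective, i.map_surjective⟩
  | succ n hn =>
    obtain ⟨Q, p, _, _, hQ⟩ := h X
    let S := ShortComplex.mk _ _ (kernel.condition p)
    have hS : S.ShortExact := shortExact_kernel p
    -- Dimension shifting along `0 → kernel p → Q → X → 0`: higher Ext from `Q` vanishes in both
    -- categories, so both Ext groups in degree `n + 1` are cokernels of the maps in degree `n`.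
    exact AddMonoidHom.bijective_of_surjective_of_bijective_of_right_exact _ _ _ _
      (i.mapExtAddHom S.X₂ Y n) (i.mapExtAddHom S.X₁ Y n) (i.mapExtAddHom S.X₃ Y (n + 1))
      (by cat_disch) (by cat_disch)
      ((ShortComplex.ab_exact_iff_function_exact _).1
        (Ext.contravariant_sequence_exact₁' hS Y n (n + 1) (add_comm 1 n)))
      ((ShortComplex.ab_exact_iff_function_exact _).1
        (Ext.contravariant_sequence_exact₁' (hS.map i) (i.obj Y) n (n + 1) (add_comm 1 n)))
      (hn _).surjective (hn _)
      (fun x₃ ↦ Ext.contravariant_sequence_exact₃ hS _ x₃ (by subsingleton) (add_comm 1 n))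
      (fun y₃ ↦ Ext.contravariant_sequence_exact₃ (hS.map_of_exact i) _ y₃ (hQ _ _ _)
        (add_comm 1 n))

end Homological

/-! ### Inclusions between Serre subcategories. -/

section Inclusions

variable {A : Type u} [Category.{v} A] [Abelian A] {P P' : ObjectProperty A} [P.IsSerreClass]

theorem isExactFunctor_ιOfLE [P'.IsSerreClass] (h : P ≤ P') :
    IsExactFunctor (ObjectProperty.ιOfLE h) where
  additive := ⟨by intros; rfl⟩
  preservesFiniteLimits := by
    have : PreservesFiniteLimits (ObjectProperty.ιOfLE h ⋙ P'.ι) :=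
      (isExactFunctor_ι P).preservesFiniteLimits
    have := (isExactFunctor_ι P').preservesFiniteLimits
    exact preservesFiniteLimits_of_reflects_of_preserves _ P'.ι
  preservesFiniteColimits := by
    have : PreservesFiniteColimits (ObjectProperty.ιOfLE h ⋙ P'.ι) :=
      (isExactFunctor_ι P).preservesFiniteColimits
    have := (isExactFunctor_ι P').preservesFiniteColimits
    exact preservesFiniteColimits_of_reflects_of_preserves _ P'.ι

theorem essImage_ιOfLE_iff (h : P ≤ P') (X : P'.FullSubcategory) :
    (ObjectProperty.ιOfLE h).essImage X ↔ P X.obj := by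
  constructor
  · rintro ⟨Y, ⟨e⟩⟩
    exact P.prop_of_iso (P'.ι.mapIso e) Y.property
  · intro hX
    exact ⟨⟨X.obj, hX⟩, ⟨Iso.refl _⟩⟩

end Inclusions

end

end HighestWeight

namespace HighestWeight

noncomputable section

attribute [local instance] CategoryTheory.Abelian.hasFiniteBiproducts

/-! ### The subcategories cut out by standard objects. -/

section StandardSequences

variable {A : Type u} [Category.{v} A] [Abelian A] {n : ℕ} {Δ : Fin n → A}

/-- The objects without nonzero maps from `Δ j` for `j ≥ k`. -/
def standardSub (Δ : Fin n → A) (k : Fin (n + 1)) : ObjectProperty A :=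
  fun X => ∀ j : Fin n, k ≤ j.castSucc → ∀ f : Δ j ⟶ X, f = 0

theorem standardSub_mono (Δ : Fin n → A) : Monotone (standardSub Δ) :=
  fun _ _ hkl _ hX j hj => hX j (hkl.trans hj)

theorem standardSub_castSucc_iff (i : Fin n) (X : A) :
    standardSub Δ i.castSucc X ↔ standardSub Δ i.succ X ∧ ∀ f : Δ i ⟶ X, f = 0 := by
  refine ⟨fun h => ⟨standardSub_mono Δ i.castSucc_lt_succ.le X h, h i le_rfl⟩,
    fun h j hj => ?_⟩
  rcases (Fin.castSucc_le_castSucc_iff.1 hj).eq_or_lt with rfl | hlt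
  · exact h.2
  · exact h.1 j (Fin.succ_le_castSucc_iff.2 hlt)

namespace IsStandardSequence

/-- Projective objects mapping onto the standard objects, and the kernels of these maps. -/
theorem exists_projective (h : IsStandardSequence Δ) :
    ∃ (U P : Fin n → A) (f : ∀ i, U i ⟶ P i) (g : ∀ i, P i ⟶ Δ i) (w : ∀ i, f i ≫ g i = 0),
      (∀ i, (ShortComplex.mk (f i) (g i) (w i)).ShortExact) ∧
      (∀ i, FiltObj (Set.Ioi i) Δ (U i)) ∧ (∀ i, Projective (P i)) ∧
      IsProjectiveGenerator (⨁ P) := by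
  obtain ⟨U, P, f, g, w, hS, -, -, hU, hP⟩ := h
  refine ⟨U, P, f, g, w, hS, hU, fun i => ?_, hP⟩
  have := hP.1
  exact Retract.projective ⟨biproduct.ι P i, biproduct.π P i, biproduct.ι_π_self P i⟩

theorem end_standard (h : IsStandardSequence Δ) (i : Fin n) :
    Nontrivial (End (Δ i)) ∧ ∀ x : End (Δ i), x ≠ 0 → IsUnit x := by
  obtain ⟨U, P, f, g, w, -, h, -⟩ := h
  exact h i

theorem standardSub_standard (h : IsStandardSequence Δ) {i : Fin n} {k : Fin (n + 1)}
    (hk : i.castSucc < k) : standardSub Δ k (Δ i) := by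
  obtain ⟨U, P, f, g, w, -, -, h, -⟩ := h
  exact fun j hj => h j i (Fin.castSucc_lt_castSucc_iff.1 (hk.trans_le hj))

theorem hom_eq_zero_of_filtObj {i : Fin n} {U X : A} (hU : FiltObj (Set.Ioi i) Δ U)
    (hX : standardSub Δ i.succ X) (f : U ⟶ X) : f = 0 := by
  refine hom_eq_zero_of_filt hU ?_ f
  rintro Z ⟨j, hj, ⟨e⟩⟩ f
  rw [← cancel_epi e.inv, comp_zero]
  exact hX j (Fin.succ_le_castSucc_iff.2 hj) _

/-- The kernel U_j is filtered by later standard objects, which do not map to X either, so Hom(P_j,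
X) = Hom(Δ_j, X). Vanishing of maps from projectives visibly passes to quotients. -/
theorem exists_standardSub_iff (h : IsStandardSequence Δ) :
    ∃ P : Fin n → A, (∀ i, Projective (P i)) ∧ ∀ (k : Fin (n + 1)) (X : A),
      standardSub Δ k X ↔ ∀ j, k ≤ j.castSucc → ∀ f : P j ⟶ X, f = 0 := by
  obtain ⟨U, P, f, g, w, hS, hU, hP, -⟩ := h.exists_projective
  refine ⟨P, hP, fun k X => ⟨fun hX j hj q => ?_, fun hX j hj q => ?_⟩⟩
  · have hX' : standardSub Δ j.succ X :=
      standardSub_mono Δ (hj.trans j.castSucc_lt_succ.le) X hX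
    obtain ⟨t, ht⟩ := CokernelCofork.IsColimit.desc' (hS j).gIsCokernel q
      (hom_eq_zero_of_filtObj (hU j) hX' _)
    change g j ≫ t = q at ht
    rw [← ht, show t = 0 from hX j hj t, comp_zero]
  · have := (hS j).epi_g
    rw [← cancel_epi (g j), comp_zero]
    exact hX j hj _

theorem isSerreClass_standardSub (h : IsStandardSequence Δ) (k : Fin (n + 1)) :
    (standardSub Δ k).IsSerreClass := by
  obtain ⟨P, hP, hk⟩ := h.exists_standardSub_iff
  exact
    { exists_zero := ⟨_, isZero_zero A, fun j _ f => (isZero_zero A).eq_of_tgt _ _⟩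
      prop_of_mono := fun m _ hY j hj f => by
        rw [← cancel_mono m, zero_comp]
        exact hY j hj _
      prop_of_epi := fun p _ hX => (hk k _).2 fun j hj f => by
        have := hP j
        rw [← Projective.factorThru_comp f p, (hk k _).1 hX j hj (Projective.factorThru f p),
          zero_comp]
      prop_X₂_of_shortExact := fun {S} hS h₁ h₃ j hj f => by
        have := hS.mono_f
        obtain ⟨t, ht⟩ := KernelFork.IsLimit.lift' hS.fIsKernel f (h₃ j hj _)
        change t ≫ S.f = f at ht
        rw [← ht, h₁ j hj t, zero_comp] }

theorem standardSub_zero_iff (h : IsStandardSequence Δ) (X : A) :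
    standardSub Δ 0 X ↔ IsZero X := by
  refine ⟨fun hX => ?_, fun hX j _ f => hX.eq_of_tgt _ _⟩
  obtain ⟨U, P, f, g, w, hS, hU, hP, hG⟩ := h.exists_projective
  obtain ⟨r, -, p, _⟩ := hG.2 X
  have hp : p = 0 := by
    ext k j
    obtain ⟨t, ht⟩ := CokernelCofork.IsColimit.desc' (hS j).gIsCokernel
      (biproduct.ι P j ≫ biproduct.ι (fun _ => ⨁ P) k ≫ p)
      (hom_eq_zero_of_filtObj (hU j) (standardSub_mono Δ (Fin.zero_le _) X hX) _)
    change g j ≫ t = _ at ht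
    rw [← ht, show t = 0 from hX j (Fin.zero_le _) t]
    simp
  rw [IsZero.iff_id_eq_zero, ← cancel_epi p, hp, zero_comp, zero_comp]

theorem standardSub_succ_iff_serreObj (h : IsStandardSequence Δ) (hA : IsLengthCategory A)
    (i : Fin n) (X : A) : standardSub Δ i.succ X ↔ SerreObj (Set.Iic i) Δ X := by
  have := h.isSerreClass_standardSub i.succ
  refine prop_iff_serreObj hA _ (fun j hj => h.standardSub_standard ?_) (fun T hT hT' => ?_) X
  · exact Fin.castSucc_lt_succ_iff.2 hj
  · by_contra! H
    refine Simple.not_isZero T ((h.standardSub_zero_iff T).1 fun j _ => ?_)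
    rcases le_or_gt j i with hji | hji
    · exact H j hji
    · exact hT' j (Fin.succ_le_castSucc_iff.2 hji)

/-- Lift from P_i instead; the lift kills U_i because E receives no maps from the later standard
objects. Thus Δ_i is projective relative to A_i. -/
theorem exists_lift (h : IsStandardSequence Δ) (i : Fin n) {E X : A} (f : Δ i ⟶ X) (e : E ⟶ X)
    [Epi e] (hE : standardSub Δ i.succ E) : ∃ l : Δ i ⟶ E, l ≫ e = f := by
  obtain ⟨U, P, a, g, w, hS, hU, hP, -⟩ := h.exists_projective
  have := hP i
  have := (hS i).epi_g
  obtain ⟨l, hl⟩ := CokernelCofork.IsColimit.desc' (hS i).gIsCokernel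
    (Projective.factorThru (g i ≫ f) e) (hom_eq_zero_of_filtObj (hU i) hE _)
  change g i ≫ l = _ at hl
  refine ⟨l, ?_⟩
  rw [← cancel_epi (g i), ← Category.assoc, hl, Projective.factorThru_comp]

/-- The standard object `Δ i` as an object of the subcategory it generates together with its
predecessors. -/
def std (h : IsStandardSequence Δ) (i : Fin n) : (standardSub Δ i.succ).FullSubcategory :=
  ⟨Δ i, h.standardSub_standard i.castSucc_lt_succ⟩

theorem std_end (h : IsStandardSequence Δ) (i : Fin n) :
    Nontrivial (End (h.std i)) ∧ ∀ x : End (h.std i), x ≠ 0 → IsUnit x := by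
  obtain ⟨⟨a, b, hab⟩, h'⟩ := h.end_standard i
  refine ⟨⟨(standardSub Δ i.succ).homMk a, (standardSub Δ i.succ).homMk b,
    fun h => hab congr(($h).hom)⟩, fun x hx => ?_⟩
  rw [isUnit_iff_isIso]
  have : IsIso ((standardSub Δ i.succ).ι.map x) := (isUnit_iff_isIso (X := Δ i) x.hom).1
    (h' x.hom fun h0 => hx ((standardSub Δ i.succ).hom_ext h0))
  exact isIso_of_fully_faithful (standardSub Δ i.succ).ι x

variable [∀ k, (standardSub Δ k).IsSerreClass]

theorem projective_std (h : IsStandardSequence Δ) (i : Fin n) : Projective (h.std i) where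
  factors {E X} f e _ := by
    have := (isExactFunctor_ι (standardSub Δ i.succ)).preservesFiniteColimits
    have : Epi e.hom := inferInstanceAs (Epi ((standardSub Δ i.succ).ι.map e))
    obtain ⟨l, hl⟩ := h.exists_lift i f.hom e.hom E.property
    exact ⟨(standardSub Δ i.succ).homMk l, (standardSub Δ i.succ).hom_ext hl⟩

theorem projective_of_filt_std (h : IsStandardSequence Δ) (i : Fin n)
    {X : (standardSub Δ i.succ).FullSubcategory}
    (hX : Filt (fun Y => Nonempty (Y ≅ Δ i)) X.obj) : Projective X := by
  refine projective_of_filt (fun Y hY => ?_) (filt_fullSubcategory hX)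
  obtain ⟨e⟩ := hY
  have := h.projective_std i
  exact Projective.of_iso ((standardSub Δ i.succ).isoMk e.symm : h.std i ≅ Y) this

/-- All factors Δ_i of G can be moved to the bottom, and G' is the quotient by them. Maps from G to
objects of A_{i-1} kill the bottom part and factor through G', which therefore inherits projectivity
and generation. -/
theorem exists_generator_castSucc (h : IsStandardSequence Δ) (i : Fin n)
    {G : (standardSub Δ i.succ).FullSubcategory} (hG : Projective G)
    (hgen : ∀ X, ∃ (r : ℕ) (p : (⨁ fun _ : Fin r => G) ⟶ X), Epi p)
    (hfilt : FiltObj {j | j.castSucc < i.succ} Δ G.obj) :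
    ∃ G' : (standardSub Δ i.castSucc).FullSubcategory, Projective G' ∧
      (∀ X, ∃ (r : ℕ) (p : (⨁ fun _ : Fin r => G') ⟶ X), Epi p) ∧
      FiltObj {j | j.castSucc < i.castSucc} Δ G'.obj ∧
      ∃ S : ShortComplex (standardSub Δ i.succ).FullSubcategory, S.ShortExact ∧
        Projective S.X₁ ∧ Projective S.X₂ ∧ (∀ Y : A, (∀ f : Δ i ⟶ Y, f = 0) →
          ∀ f : S.X₁.obj ⟶ Y, f = 0) ∧ S.X₃.obj = G'.obj := by
  have hsub {j : Fin n} {k : Fin (n + 1)} (hj : j.castSucc < k) {Y : A} (e : Y ≅ Δ j) :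
      standardSub Δ k Y :=
    (standardSub Δ k).prop_of_iso e.symm (h.standardSub_standard hj)
  obtain ⟨S, hS, hS₁, hS₂, hS₃⟩ := exists_shortExact_of_filt
    (Q := fun Y => ∃ j ∈ {j : Fin n | j.castSucc < i.castSucc}, Nonempty (Y ≅ Δ j)) (Δ := Δ i)
    (standardSub Δ i.succ) (fun Y ⟨j, hj, ⟨e⟩⟩ => hsub (hj.trans i.castSucc_lt_succ) e)
    (h.standardSub_standard i.castSucc_lt_succ)
    (fun X p hX _ => h.exists_lift i (𝟙 _) p hX) (Filt.mono (fun Y ⟨j, hj, ⟨e⟩⟩ => by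
      rcases (Fin.castSucc_lt_succ_iff.1 hj).eq_or_lt with rfl | hlt
      · exact .inr ⟨e⟩
      · exact .inl ⟨j, Fin.castSucc_lt_castSucc_iff.2 hlt, ⟨e⟩⟩) hfilt)
  have hG' : standardSub Δ i.castSucc S.X₃ :=
    hS₃.prop fun Y ⟨j, hj, ⟨e⟩⟩ => hsub hj e
  have hD (Y : A) (hY : ∀ f : Δ i ⟶ Y, f = 0) (f : S.X₁ ⟶ Y) : f = 0 :=
    hom_eq_zero_of_filt hS₁ (fun Z ⟨e⟩ f => by rw [← cancel_epi e.inv, hY (e.inv ≫ f), comp_zero]) f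
  have hX₁ : standardSub Δ i.succ S.X₁ :=
    hS₁.prop fun Y ⟨e⟩ => hsub i.castSucc_lt_succ e
  have hX₂ : standardSub Δ i.succ S.X₂ := hS₂ ▸ G.property
  have := hS.epi_g
  obtain ⟨G, hGP⟩ := G
  obtain rfl : S.X₂ = G := hS₂
  let P := standardSub Δ i.succ
  let Q := standardSub Δ i.castSucc
  have hle : Q ≤ P := standardSub_mono Δ i.castSucc_lt_succ.le
  let F := ObjectProperty.ιOfLE hle
  have hfactor {Y : A} (hY : Q Y) (f : S.X₂ ⟶ Y) : ∃ t : S.X₃ ⟶ Y, S.g ≫ t = f :=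
    ⟨_, (CokernelCofork.IsColimit.desc' hS.gIsCokernel f
      (hD _ (hY i le_rfl) _)).2⟩
  refine ⟨⟨S.X₃, hG'⟩, ⟨fun {E X} f e _ => ?_⟩, fun X => ?_, hS₃, _,
    shortExact_homMk (X₁ := ⟨S.X₁, hX₁⟩) (X₂ := ⟨S.X₂, hGP⟩) (X₃ := ⟨S.X₃, hle _ hG'⟩)
      (w := S.zero) hS, h.projective_of_filt_std i hS₁, hG, hD, rfl⟩
  · have := (isExactFunctor_ιOfLE hle).preservesFiniteColimits
    have : Epi (F.map e) := inferInstance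
    let l : (⟨S.X₂, hGP⟩ : P.FullSubcategory) ⟶ F.obj E :=
      Projective.factorThru (P.homMk (S.g ≫ f.hom)) (F.map e)
    have hl' : l ≫ F.map e = P.homMk (S.g ≫ f.hom) := Projective.factorThru_comp _ _
    have hl : l.hom ≫ e.hom = S.g ≫ f.hom := congr(($hl').hom)
    obtain ⟨t, ht⟩ := hfactor E.property l.hom
    refine ⟨Q.homMk t, Q.hom_ext ?_⟩
    change t ≫ e.hom = f.hom
    rw [← cancel_epi S.g, ← Category.assoc, ht, hl]
  · obtain ⟨r, p, hp⟩ := hgen (F.obj X)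
    choose t ht using fun k => hfactor X.property (biproduct.ι (fun _ : Fin r => _) k ≫ p).hom
    refine ⟨r, biproduct.desc fun k => Q.homMk (t k), Preadditive.epi_of_cancel_zero _
      fun {Z} z hz => F.map_injective ?_⟩
    rw [Functor.map_zero, ← cancel_epi p, comp_zero]
    refine biproduct.hom_ext' _ _ fun k => P.hom_ext ?_
    rw [comp_zero, ← Category.assoc]
    change (biproduct.ι (fun _ : Fin r => _) k ≫ p).hom ≫ z.hom = 0
    have hz' := congr(biproduct.ι _ k ≫ $hz)
    rw [biproduct.ι_desc_assoc, comp_zero] at hz'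
    rw [← ht, Category.assoc, show t k ≫ z.hom = 0 from congr(($hz').hom), comp_zero]

end IsStandardSequence

end StandardSequences

end

end HighestWeight

namespace HighestWeight

noncomputable section

attribute [local instance] CategoryTheory.Abelian.hasFiniteBiproducts

/-! ### From standard objects to a chain of recollements. -/

namespace IsStandardSequence

variable {A : Type u} [Category.{v} A] [Abelian A] {n : ℕ} {Δ : Fin n → A}
  [∀ k, (standardSub Δ k).IsSerreClass]

theorem exists_generator_last (h : IsStandardSequence Δ) :
    ∃ G : (standardSub Δ (Fin.last n)).FullSubcategory, Projective G ∧
      (∀ X, ∃ (r : ℕ) (p : (⨁ fun _ : Fin r => G) ⟶ X), Epi p) ∧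
      FiltObj {j | j.castSucc < Fin.last n} Δ G.obj := by
  obtain ⟨U, P, f, g, w, hS, hU, hP, hG⟩ := h.exists_projective
  let Q := standardSub Δ (Fin.last n)
  have hQ (X : A) : Q X := fun j hj => absurd hj (not_le_of_gt j.castSucc_lt_last)
  have := hG.1
  refine ⟨⟨⨁ P, hQ _⟩, ⟨fun {E X} f e _ => ?_⟩, fun X => ?_, ?_⟩
  · have := (isExactFunctor_ι Q).preservesFiniteColimits
    have : Epi e.hom := inferInstanceAs (Epi (Q.ι.map e))
    exact ⟨Q.homMk (Projective.factorThru f.hom e.hom),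
      Q.hom_ext (Projective.factorThru_comp _ _)⟩
  · obtain ⟨r, -, p, _⟩ := hG.2 X.obj
    refine ⟨r, biproduct.desc fun k => Q.homMk (biproduct.ι (fun _ : Fin r => ⨁ P) k ≫ p),
      Preadditive.epi_of_cancel_zero _ fun {Z} z hz => Q.hom_ext ?_⟩
    change z.hom = 0
    rw [← cancel_epi p, comp_zero]
    refine biproduct.hom_ext' _ _ fun k => ?_
    have hz' := congr(biproduct.ι _ k ≫ $hz)
    rw [biproduct.ι_desc_assoc, comp_zero] at hz'
    rw [comp_zero, ← Category.assoc]
    exact congr(($hz').hom)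
  · refine Filt.flatten (filt_biproduct P fun i => ?_)
    refine Filt.step _ (hS i) (Filt.mono ?_ (hU i)) ⟨i, i.castSucc_lt_last, ⟨Iso.refl _⟩⟩
    rintro Y ⟨j, -, e⟩
    exact ⟨j, j.castSucc_lt_last, e⟩

theorem exists_generator (h : IsStandardSequence Δ) (k : Fin (n + 1)) :
    ∃ G : (standardSub Δ k).FullSubcategory, Projective G ∧
      (∀ X, ∃ (r : ℕ) (p : (⨁ fun _ : Fin r => G) ⟶ X), Epi p) ∧
      FiltObj {j | j.castSucc < k} Δ G.obj := by
  induction k using Fin.reverseInduction with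
  | last => exact h.exists_generator_last
  | cast i ih =>
    obtain ⟨G, h₁, h₂, h₃⟩ := ih
    obtain ⟨G', h₁', h₂', h₃', -⟩ := h.exists_generator_castSucc i h₁ h₂ h₃
    exact ⟨G', h₁', h₂', h₃'⟩

theorem standardSub_le_succ (Δ : Fin n → A) (i : Fin n) :
    standardSub Δ i.castSucc ≤ standardSub Δ i.succ :=
  standardSub_mono Δ i.castSucc_lt_succ.le

theorem isHomologicalEmbedding (h : IsStandardSequence Δ) (i : Fin n)
    (hi : IsExactFunctor (ObjectProperty.ιOfLE (standardSub_le_succ Δ i))) :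
    IsHomologicalEmbedding (ObjectProperty.ιOfLE (standardSub_le_succ Δ i)) hi := by
  have _ : HasExt.{max u v} (standardSub Δ i.succ).FullSubcategory := HasExt.standard _
  obtain ⟨G, h₁, h₂, h₃⟩ := h.exists_generator i.succ
  obtain ⟨G', h₁', h₂', h₃', S, hS, hS₁, hS₂, hSY, hS₃⟩ := h.exists_generator_castSucc i h₁ h₂ h₃
  refine isHomologicalEmbedding_of_acyclic _ hi fun X => ?_
  obtain ⟨r, p, hp⟩ := h₂' X
  refine ⟨_, p, hp, projective_biproduct _ fun _ => h₁', fun Y m => ?_⟩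
  refine ext_eq_zero_of_filt (Filt.map _ hi (Q := fun Z => Z = G')
    (Q' := fun Z => Z = S.X₃) ?_ (filt_biproduct _ fun _ => rfl)) ?_
  · rintro _ rfl
    exact ObjectProperty.FullSubcategory.ext hS₃.symm
  -- The resolution of G' by `S.X₁` and `S.X₂` shifts degrees: the class comes from Ext^m(S.X₁, Y).
  -- For m = 0 this vanishes because Y receives no maps from Δ_i, and for m > 0 because `S.X₁` is
  -- projective.
  · rintro _ rfl x
    obtain ⟨y, rfl⟩ := Ext.contravariant_sequence_exact₃ hS _ x (Ext.eq_zero_of_projective _)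
      (add_comm 1 m)
    have hy : y = 0 := by
      cases m with
      | zero =>
        obtain ⟨f, rfl⟩ := (Ext.mk₀_bijective _ _).2 y
        rw [show f = 0 from (standardSub Δ i.succ).hom_ext
          (hSY _ (fun g => Y.property i le_rfl g) f.hom), Ext.mk₀_zero]
      | succ m => exact Ext.eq_zero_of_projective y
    rw [hy, Ext.comp_zero]

theorem exists_recollement (h : IsStandardSequence Δ) (hA : IsLengthCategory A)
    (hsimple : HasFinitelyManySimples A) (hext : ExtFinite Aᵒᵖ) (i : Fin n) :
    ∃ (Γ : Type v) (_ : DivisionRing Γ)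
      (R : Recollement (ObjectProperty.ιOfLE (standardSub_le_succ Δ i)) (FGModuleCat.{v} Γᵐᵒᵖ)),
      Nonempty (R.jLeft.obj (regularModule Γ) ≅ h.std i) := by
  obtain ⟨G, -, hG, -⟩ := h.exists_generator i.succ
  have := h.projective_std i
  refine HighestWeight.exists_recollement (ObjectProperty.ιOfLE (standardSub_le_succ Δ i))
    (isLengthCategory_fullSubcategory _ hA) (hasFinitelyManySimples_fullSubcategory _ hsimple)
    (extFinite_op_fullSubcategory _ hext) hG (h.std_end i)
    (isExactFunctor_ιOfLE (standardSub_le_succ Δ i)) fun X => ?_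
  rw [essImage_ιOfLE_iff, standardSub_castSucc_iff]
  refine ⟨fun hX f => (standardSub Δ i.succ).hom_ext (hX.2 f.hom),
    fun hX => ⟨X.property, fun f => ?_⟩⟩
  exact congr(($(hX ((standardSub Δ i.succ).homMk f : h.std i ⟶ X))).hom)

/-- The chain of recollements given by the standard objects of a highest weight category. -/
theorem exists_recollementChain (h : IsStandardSequence Δ) (hA : IsLengthCategory A)
    (hsimple : HasFinitelyManySimples A) (hext : ExtFinite Aᵒᵖ) :
    ∃ C : RecollementChain A n, C.sub = standardSub Δ ∧
      ∀ i, Nonempty (C.standardObject i ≅ Δ i) := by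
  choose Γ hΓ R hR using h.exists_recollement hA hsimple hext
  refine ⟨{ sub := standardSub Δ
            closedUnderIso := inferInstance
            le_succ := standardSub_le_succ Δ
            sub_zero := h.standardSub_zero_iff
            sub_last := fun X j hj => absurd hj (not_le_of_gt j.castSucc_lt_last)
            isAbelian := inferInstance
            Γ := Γ
            divisionRing := hΓ
            recollement := R
            isHomological := fun i => h.isHomologicalEmbedding i _ }, rfl, fun i => ?_⟩
  obtain ⟨e⟩ := hR i
  exact ⟨(standardSub Δ i.succ).ι.mapIso e⟩

end IsStandardSequence

end

end HighestWeight

theorem mainTheorem1 {A : Type u} [Category.{v} A] [Abelian A]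
    (hlength : HighestWeight.IsLengthCategory A)
    (hsimple : HighestWeight.HasFinitelyManySimples A)
    (hext : HighestWeight.ExtFinite A)
    (hextop : HighestWeight.ExtFinite Aᵒᵖ) :
    (HighestWeight.IsHighestWeightCategory A ↔
      ∃ n : ℕ, Nonempty (HighestWeight.RecollementChain A n)) ∧
    (∀ (n : ℕ) (C : HighestWeight.RecollementChain A n),
      HighestWeight.IsStandardSequence C.standardObject ∧
      (∀ (i : Fin n) (X : A), C.sub i.succ X ↔
        HighestWeight.SerreObj (Set.Iic i) C.standardObject X) ∧
      (∀ (i : Fin n) (X : A), C.sub i.castSucc X ↔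
        C.sub i.succ X ∧ ∀ f : C.standardObject i ⟶ X, f = 0)) ∧
    (∀ (n : ℕ) (Δ : Fin n → A), HighestWeight.IsStandardSequence Δ →
      ∃ C : HighestWeight.RecollementChain A n,
        (∀ i, Nonempty (C.standardObject i ≅ Δ i)) ∧
        (∀ (i : Fin n) (X : A), C.sub i.succ X ↔ HighestWeight.SerreObj (Set.Iic i) Δ X) ∧
        (∀ (i : Fin n) (X : A), C.sub i.castSucc X ↔
          C.sub i.succ X ∧ ∀ f : Δ i ⟶ X, f = 0)) := by
  have key (n : ℕ) (Δ : Fin n → A) (h : HighestWeight.IsStandardSequence Δ) :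
      ∃ C : HighestWeight.RecollementChain A n,
        (∀ i, Nonempty (C.standardObject i ≅ Δ i)) ∧
        (∀ (i : Fin n) (X : A), C.sub i.succ X ↔ HighestWeight.SerreObj (Set.Iic i) Δ X) ∧
        (∀ (i : Fin n) (X : A), C.sub i.castSucc X ↔
          C.sub i.succ X ∧ ∀ f : Δ i ⟶ X, f = 0) := by
    have := h.isSerreClass_standardSub
    obtain ⟨C, hC, e⟩ := h.exists_recollementChain hlength hsimple hextop
    refine ⟨C, e, ?_⟩
    rw [hC]
    exact ⟨h.standardSub_succ_iff_serreObj hlength, HighestWeight.standardSub_castSucc_iff⟩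
  refine ⟨⟨?_, ?_⟩, fun n C => ⟨C.isStandardSequence hlength hext,
    C.sub_succ_iff_serreObj hlength, C.sub_castSucc_iff⟩, key⟩
  · rintro ⟨n, Δ, h⟩
    obtain ⟨C, -⟩ := key n Δ h
    exact ⟨n, ⟨C⟩⟩
  · rintro ⟨n, ⟨C⟩⟩
    exact ⟨n, C.standardObject, C.isStandardSequence hlength hext⟩
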